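/- Conventions. All simplicial complexes are finite. $X(k)$ is the set of $k$-dimensional faces of a complex $X$ (those with $k+1$ vertices), $X_z=\{x-z : z\subseteq x\in X\}$ is the link at a face $z$, and $X$ is a $d$-complex if every face lies in a $d$-face. The degree $D(X)$ of a $d$-complex is the largest number of $d$-faces containing a given vertex, and its canonical weight is $w(x)=\binom{d+1}{k+1}^{-1}|X(d)|^{-1}\,|\{y\in X(d): y\supseteq x\}|$ for $x\in X(k)$. The weighted graph underlying $X$ is a $[-1,\lambda]$-spectral expander if the spectrum of the operator $(\mathcal A f)(x)=\sum_{e\in X(1),\,e\supseteq x}\frac{w(e)}{2w(x)}f(e-x)$ on the space of functions $f:X(0)\to\mathbb R$ with $\sum_{x\in X(0)} w(x)f(x)=0$ is contained in $[-1,\lambda]$. An $\mathbb F$-sheaf $\mathcal F$ on $X$ consists of $\mathbb F$-vector spaces $\mathcal F(x)$, for $\emptyset\neq x\in X$, and linear maps $\mathrm{res}_{y\leftarrow x}:\mathcal F(x)\to\mathcal F(y)$, for $\emptyset\ne x\subsetneq y\in X$, with $\mathrm{res}_{z\leftarrow y}\circ\mathrm{res}_{y\leftarrow x}=\mathrm{res}_{z\leftarrow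 x}$. It is locally constant if for every face $z\ne\emptyset$ the augmented sheaf $x\mapsto\mathcal F(x\cup z)$ on $X_z$ (the empty face included) is isomorphic to a constant one; it has dimension $m$ if $\dim\mathcal F(x)=m$ for all $x\neq\emptyset$. Fix a linear order on the vertices and put $C^k(X,\mathcal F)=\prod_{x\in X(k)}\mathcal F(x)$ and $Z^k(X,\mathcal F)=\ker(d_k:C^k\to C^{k+1})$, where $(d_kf)(y)=\sum_{x\in X(k),\,x\subseteq y}[y:x]\,\mathrm{res}_{y\leftarrow x}f(x)$ and $[y:x]=(-1)^i$ if $x$ is obtained from $y$ by removing its $i$-th vertex (counted from $0$). If $\dim\mathcal F(x)=n$ for all $x\in X(k)$, the $k$-cocycle code of $(X,\mathcal F)$ is $Z^k(X,\mathcal F)\subseteq C^k(X,\mathcal F)\cong\Sigma^{X(k)}$ with alphabet $\Sigma=\mathbb F^n$, each $\mathcal F(x)$ being identified linearly with $\Sigma$. The relative distance of a code $C\subseteq\Sigma^N$ is the minimum of the normalized Hamming distances of distinct code words ($\infty$ if there are no two distinct ones), and its rate is $\log_{|\Sigma^N|}|C|$. **Theorem.** Let $Q,D,r,m$ be nonnegative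 integers, $\lambda\in[-1,1]$ and $\kappa\in[1,2]$, with $0<r<m$ and $\frac{\kappa}{Q}<\frac rm<\frac2Q$, and suppose that $$\lambda\le\min\Big\{\tfrac16\Big(\tfrac14(1-\lambda)\big(1-\tfrac{\kappa/Q}{r/m}\big)-\lambda\Big)^2(1-\lambda),\ \tfrac14(1-\lambda)\big(1-\tfrac{\kappa/Q}{r/m}\big)\Big\}.$$ Then there is $\delta>0$, depending only on $Q,\lambda,r,m,\kappa$ and $D$, such that the following holds. Let $X$ be a connected $d$-complex, $d\ge2$, with $D(X)=D$, such that 1. every $0$-face of $X$ is contained in exactly $Q$ edges; 2. the weighted graph underlying $X_v$ is a $[-1,\lambda]$-spectral expander for every $v\in X(0)$; 3. $\kappa^{-1}w(e)\le w(e')\le\kappa w(e)$ for all $e,e'\in X(1)$ sharing a vertex. Let $\mathbb F$ be a finite field, let $\mathcal F$ be a locally constant $\mathbb F$-sheaf of dimension $m$ on $X$, and for every $e\in X(1)$ let $U(e)\subseteq\mathcal F(e)$ be an $(m-r)$-dimensional subspace, such that 4. for every $v\in X(0)$ and every set $S$ of edges containing $v$ with $|S|r\ge m$, we have $\bigcap_{e\in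 S}\mathrm{res}_{e\leftarrow v}^{-1}U(e)=0$. Let $\mathcal G$ be the subsheaf of $\mathcal F$ with $\mathcal G(v)=0$ for $v\in X(0)$, $\mathcal G(e)=U(e)$ for $e\in X(1)$, and $\mathcal G(x)=\mathcal F(x)$ for $x\in X$ of dimension $>1$. Then the $1$-cocycle code of $(X,\mathcal G)$, with alphabet $\Sigma=\mathbb F^{m-r}$, has relative distance at least $\delta$ and rate at least $\frac2Q-\frac rm-\frac1{|X(1)|}$. -/

import Mathlib

universe u v w

open scoped ENNReal

namespace SheafCode

/-! ### Finite simplicial complexes and their canonical weights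

Simplicial complexes are those of Mathlib; the empty face is left implicit. -/

section Complexes

variable {V : Type u}

open Classical in
/-- The set `K(k)` of `k`-dimensional faces, that is, of faces with `k + 1` vertices. -/
noncomputable def kFaces [Fintype V] (K : PreAbstractSimplicialComplex V) (k : ℕ) :
    Finset (Finset V) :=
  Finset.univ.filter fun x => x ∈ K ∧ x.card = k + 1

theorem mem_kFaces [Fintype V] {K : PreAbstractSimplicialComplex V} {k : ℕ} {x : Finset V} :
    x ∈ kFaces K k ↔ x ∈ K ∧ x.card = k + 1 := by
  simp [kFaces]

/-- A `k`-face, regarded as a face. -/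
def toFace [Fintype V] {K : PreAbstractSimplicialComplex V} {k : ℕ}
    (x : kFaces K k) : K :=
  ⟨x.1, (mem_kFaces.1 x.2).1⟩

/-- `K` is pure of dimension `d`: there is a `d`-face, and every face lies in a `d`-face. -/
def IsPure [Fintype V] (K : PreAbstractSimplicialComplex V) (d : ℕ) : Prop :=
  (kFaces K d).Nonempty ∧ ∀ x ∈ K, ∃ y ∈ kFaces K d, x ⊆ y

/-- The underlying graph of a simplicial complex with vertex set `V`. -/
def underlyingGraph [DecidableEq V] (X : AbstractSimplicialComplex V) : SimpleGraph V where
  Adj a b := a ≠ b ∧ ({a, b} : Finset V) ∈ X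
  symm := ⟨fun a b h => ⟨h.1.symm, by rw [Finset.pair_comm]; exact h.2⟩⟩
  loopless := ⟨fun _ h => h.1 rfl⟩

/-- The link of `K` at `z`: the sets `x` disjoint from `z` such that `x ∪ z` is a face. -/
def link [DecidableEq V] (K : PreAbstractSimplicialComplex V) (z : Finset V) :
    PreAbstractSimplicialComplex V where
  faces := {x | x.Nonempty ∧ Disjoint x z ∧ x ∪ z ∈ K}
  isRelLowerSet_faces := by
    rintro x ⟨hx, hxz, hK⟩
    refine ⟨hx, fun y hy hne => ⟨hne, Disjoint.mono_left hy hxz, ?_⟩⟩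
    exact (K.isRelLowerSet_faces hK).2 (Finset.union_subset_union_left hy)
      (hne.mono Finset.subset_union_left)

/-- The degree of a complex of dimension `d`: the largest number of `d`-faces containing
a given vertex. -/
noncomputable def degree [Fintype V] [DecidableEq V] (K : PreAbstractSimplicialComplex V)
    (d : ℕ) : ℕ :=
  Finset.univ.sup fun a : V => ((kFaces K d).filter fun y => a ∈ y).card

/-- The canonical weight of a face `x` of a complex that is pure of dimension `d`. -/
noncomputable def weight [Fintype V] [DecidableEq V] (K : PreAbstractSimplicialComplex V)
    (d : ℕ) (x : Finset V) : ℝ :=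
  (((kFaces K d).filter fun y => x ⊆ y).card : ℝ) /
    (((d + 1).choose x.card : ℝ) * ((kFaces K d).card : ℝ))

/-- The weighted adjacency operator on real functions on `K(0)`:
`(𝒜 f)(x) = ∑ w(e) / (2 w(x)) * f(e - x)`, the sum being over the edges `e` that contain `x`.
An edge `e` containing `x` is written as `x ∪ y`, where `y = e - x`. -/
noncomputable def adjacencyOperator [Fintype V] [DecidableEq V]
    (K : PreAbstractSimplicialComplex V) (d : ℕ) :
    Module.End ℝ (kFaces K 0 → ℝ) :=
  Matrix.toLin' (Matrix.of fun x y : kFaces K 0 =>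
    if (x.1 ∪ y.1) ∈ kFaces K 1 then weight K d (x.1 ∪ y.1) / (2 * weight K d x.1) else 0)

/-- The underlying weighted graph of `K` (pure of dimension `d`) is a spectral `I`-expander:
the spectrum of the weighted adjacency operator on the functions of weighted sum zero, which is
the set of its eigenvalues there, is contained in `I`. -/
def IsSpectralExpander [Fintype V] [DecidableEq V] (K : PreAbstractSimplicialComplex V)
    (d : ℕ) (I : Set ℝ) : Prop :=
  ∀ (μ : ℝ) (f : kFaces K 0 → ℝ), ∑ x, weight K d x.1 * f x = 0 →
    (adjacencyOperator K d).HasEigenvector μ f → μ ∈ I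

end Complexes

/-! ### Sheaves on simplicial complexes -/

/-- A sheaf of `𝔽`-vector spaces on the (nonempty) faces of a simplicial complex. -/
structure Sheaf {V : Type u} (K : PreAbstractSimplicialComplex V) (𝔽 : Type v) [Field 𝔽] where
  obj : K → Type w
  [addCommGroup : ∀ x, AddCommGroup (obj x)]
  [module : ∀ x, Module 𝔽 (obj x)]
  res : ∀ {x y : K}, x < y → obj x →ₗ[𝔽] obj y
  res_res : ∀ {x y z : K} (hxy : x < y) (hyz : y < z) (f : obj x),
    res hyz (res hxy f) = res (hxy.trans hyz) f

attribute [instance] Sheaf.addCommGroup Sheaf.module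

section Sheaves

variable {V : Type u} {K : PreAbstractSimplicialComplex V} {𝔽 : Type v} [Field 𝔽]

/-- `F` is locally constant: for every nonempty face `z`, the augmented sheaf
`x ↦ F (x ∪ z)` on the link of `z` (the empty face included) is isomorphic to a constant
augmented sheaf `A`. The faces `x` of the link, the empty one included, correspond to the faces
`y = x ∪ z` containing `z`. -/
def Sheaf.IsLocallyConstant (F : Sheaf.{u, v, w} K 𝔽) : Prop :=
  ∀ z : K, ∃ (A : Type w) (_ : AddCommGroup A) (_ : Module 𝔽 A)
    (φ : ∀ y : {y : K // z ≤ y}, A ≃ₗ[𝔽] F.obj y.1),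
    ∀ (y y' : {y : K // z ≤ y}) (h : y.1 < y'.1) (a : A), F.res h (φ y a) = φ y' a

/-- All the spaces `F x` have dimension `m`. -/
def Sheaf.HasDim (F : Sheaf.{u, v, w} K 𝔽) (m : ℕ) : Prop :=
  ∀ x : K, Module.finrank 𝔽 (F.obj x) = m

/-- A subsheaf: subspaces of the `F x` that are preserved by the restriction maps. -/
structure Subsheaf (F : Sheaf.{u, v, w} K 𝔽) where
  carrier : ∀ x : K, Submodule 𝔽 (F.obj x)
  res_mem : ∀ {x y : K} (h : x < y), ∀ f ∈ carrier x, F.res h f ∈ carrier y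

/-- A subsheaf, regarded as a sheaf. -/
def Subsheaf.toSheaf {F : Sheaf.{u, v, w} K 𝔽} (G : Subsheaf F) : Sheaf.{u, v, w} K 𝔽 where
  obj x := G.carrier x
  res h := (F.res h).restrict (G.res_mem h)
  res_res hxy hyz f := Subtype.ext (F.res_res hxy hyz f.1)

/-- The sign `[y : x] = (-1) ^ i`, where `x` is obtained from `y` by removing its `i`-th vertex
(counted from `0` in increasing order): `i` is the number of vertices of `y` below the removed
vertex. -/
def incidenceSign [LinearOrder V] (y x : Finset V) : ℤ :=
  (-1) ^ (y.filter fun a => ∃ b ∈ y \ x, a < b).card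

/-- The space `C^k(K, F)`, the product of the `F x` over the `k`-faces `x`; an alternating cochain
on ordered faces is identified with its values on the increasingly ordered faces. -/
abbrev Sheaf.Cochain [Fintype V] (F : Sheaf.{u, v, w} K 𝔽) (k : ℕ) : Type (max u w) :=
  ∀ x : kFaces K k, F.obj (toFace x)

open Classical in
/-- The coboundary map `(d_k f)(y) = ∑ [y : x] res_{y ← x} f(x)`, the sum being over the
`k`-faces `x` of the `(k + 1)`-face `y`. -/
noncomputable def Sheaf.coboundary [Fintype V] [LinearOrder V] (F : Sheaf.{u, v, w} K 𝔽) (k : ℕ) :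
    F.Cochain k →ₗ[𝔽] F.Cochain (k + 1) :=
  LinearMap.pi fun y => ∑ x : kFaces K k,
    if h : toFace x < toFace y then
      (incidenceSign y.1 x.1 : 𝔽) • (F.res h ∘ₗ LinearMap.proj x)
    else 0

/-- The space `Z^k(K, F)` of `k`-cocycles. -/
noncomputable def Sheaf.cocycles [Fintype V] [LinearOrder V] (F : Sheaf.{u, v, w} K 𝔽) (k : ℕ) :
    Submodule 𝔽 (F.Cochain k) :=
  LinearMap.ker (F.coboundary k)

/-- The `k`-cocycle code of `F` inside `Σ ^ K(k)`, where `Σ = 𝔽 ^ n`. Here `φ` consists of the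
identifications of the spaces `F x`, for `x` a `k`-face, with the alphabet `Σ`. -/
def Sheaf.cocycleCode [Fintype V] [LinearOrder V] (F : Sheaf.{u, v, w} K 𝔽) (k n : ℕ)
    (φ : ∀ x : kFaces K k, F.obj (toFace x) ≃ₗ[𝔽] (Fin n → 𝔽)) :
    Set (kFaces K k → (Fin n → 𝔽)) :=
  {c | (fun x => (φ x).symm (c x)) ∈ F.cocycles k}

end Sheaves

/-! ### Codes -/

section Codes

variable {ι : Type u} {A : Type v} [Fintype ι]

open Classical in
/-- The relative distance of a code inside `A ^ ι`: the minimum of the normalized Hamming distances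
between distinct code words (`∞` if there are no two distinct code words). -/
noncomputable def relativeDistance (C : Set (ι → A)) : ℝ≥0∞ :=
  ⨅ f ∈ C, ⨅ g ∈ C, ⨅ _ : f ≠ g, (hammingDist f g : ℝ≥0∞) / (Fintype.card ι : ℝ≥0∞)

/-- The rate `log_{|A ^ ι|} |C|` of a code inside `A ^ ι`. -/
noncomputable def rate (C : Set (ι → A)) : ℝ :=
  Real.logb (Nat.card (ι → A)) (Nat.card C)

end Codes

/-! ### The sheaf of the construction -/

section Construction

variable {V : Type u} [Fintype V] {𝔽 : Type v} [Field 𝔽]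

theorem vertex_lt_edge (X : AbstractSimplicialComplex V) (a : V)
    (e : {e : kFaces X.toPreAbstractSimplicialComplex 1 // a ∈ e.1}) :
    (⟨{a}, X.singleton_mem a⟩ : X.toPreAbstractSimplicialComplex) < toFace e.1 := by
  change ({a} : Finset V) < e.1.1
  have hc := (mem_kFaces.1 e.1.2).2
  refine lt_of_le_of_ne (Finset.singleton_subset_iff.2 e.2) fun h => ?_
  rw [← h] at hc
  simp at hc

/-- General position of the subspaces `U e`: for every vertex `a` and every set `S` of edges
containing `a` with `|S| r ≥ m`, the preimages in `F {a}` of the `U e`, `e ∈ S`, intersect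
in zero. -/
def GeneralPosition {X : AbstractSimplicialComplex V}
    (F : Sheaf.{u, v, w} X.toPreAbstractSimplicialComplex 𝔽) (r m : ℕ)
    (U : ∀ e : kFaces X.toPreAbstractSimplicialComplex 1, Submodule 𝔽 (F.obj (toFace e))) : Prop :=
  ∀ (a : V) (S : Finset {e : kFaces X.toPreAbstractSimplicialComplex 1 // a ∈ e.1}),
    m ≤ S.card * r →
      ⨅ e ∈ S, (U e.1).comap (F.res (vertex_lt_edge X a e)) = ⊥

/-- The subsheaf `G` of `F` with `G x = 0` on vertices, `G e = U e` on edges, and `G x = F x` on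
faces of dimension greater than `1`. -/
def edgeSubsheaf {K : PreAbstractSimplicialComplex V} (F : Sheaf.{u, v, w} K 𝔽)
    (U : ∀ e : kFaces K 1, Submodule 𝔽 (F.obj (toFace e))) : Subsheaf F where
  carrier x :=
    if h : x.1.card = 2 then U ⟨x.1, mem_kFaces.2 ⟨x.2, h⟩⟩
    else if x.1.card = 1 then ⊥ else ⊤
  res_mem := by
    intro x y hxy f hf
    have hlt : x.1.card < y.1.card := Finset.card_lt_card hxy
    have hpos : 0 < x.1.card := Finset.card_pos.2 (K.isRelLowerSet_faces x.2).1
    by_cases h1 : x.1.card = 1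
    · have hf0 : f = 0 := by simpa [h1] using hf
      rw [hf0, map_zero]
      exact Submodule.zero_mem _
    · have hy2 : y.1.card ≠ 2 := by omega
      have hy1 : y.1.card ≠ 1 := by omega
      simp [hy1, hy2]

end Construction

end SheafCode

open SheafCode

/-!
The rate bound is a dimension count. Since `F` is locally constant and the complex is connected, a
`0`-cochain that vanishes at one vertex and has zero coboundary is zero. So the `0`-cochains that
vanish at one vertex and whose coboundary lies in the subspaces `U e`, a space of dimension at least
`m |X(0)| - m - r |X(1)|`, embed into the cocycles
(`Sheaf.IsLocallyConstant.le_finrank_cocycles_edgeSubsheaf`), and `2 |X(1)| = Q |X(0)|`.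

For the distance, let `f` be a cocycle of small support with `f e ∈ U e` for all edges `e`. In the
star of a vertex `v` the sheaf is constant, so that `f` labels the vertices of the link of `v` by
vectors, and adjacent vertices of the link with different labels form an edge in the support of
`f`, opposite to `v`. By general position, no nonzero label occurs on `m / r` or more edges
(`GeneralPosition.card_mul_lt`), so it has less than the fraction `(κ / Q) / (r / m)` of the weight of
the link; by expansion of the link, a definite share of the pairs in the link that start in the
support have different labels (`TriangleWeight.LinkGap.monochromatic_le`). On the other hand, a
triangle with exactly two edges in the support is seen once as a pair with equal nonzero labels and
twice as a pair with one label zero. The two counts contradict each other if the support is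
spread thinly over the vertices. The vertices where it is not are few, hence by the mixing lemma in
the underlying graph they have few edges among themselves, and the contradiction persists
(`TriangleWeight.LinkGap.sum_edge_support_eq_zero`). The expansion of the underlying graph follows from
that of the links by Oppenheim's trickling-down theorem (`TriangleWeight.LinkGap.graphGap`).

All spectral hypotheses are used in the form of bounds on quadratic forms. Canonical weights are
replaced by the numbers of top-dimensional faces containing a given triangle, which removes all
normalizing constants. Negative values of `lam` are replaced by `0`.
-/

/-! ### Quadratic forms of weighted graphs -/

namespace SheafCode

open Matrix in
/-- A spectral gap on the functions of weighted mean zero bounds the quadratic form of a weighted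
graph on all functions. The vertex weights are the row sums `∑ y, M x y`, which may vanish, and
the eigenvalue equation is that of the random walk `M x y / ∑ y, M x y`, multiplied out. -/
theorem quadForm_le_of_eigenvalue_le {ι : Type*} [Fintype ι] (M : ι → ι → ℝ)
    (hsymm : ∀ x y, M x y = M y x) (hnn : ∀ x y, 0 ≤ M x y) {lam : ℝ} (hlam : 0 ≤ lam)
    (hev : ∀ (μ : ℝ) (f : ι → ℝ), ∑ x, (∑ y, M x y) * f x = 0 →
      (∃ x, (∑ y, M x y) ≠ 0 ∧ f x ≠ 0) →
      (∀ x, ∑ y, M x y * f y = μ * (∑ y, M x y) * f x) → μ ≤ lam) (f : ι → ℝ) :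
    ∑ x, ∑ y, M x y * f x * f y ≤
      lam * ∑ x, (∑ y, M x y) * f x ^ 2 +
        (1 - lam) * (∑ x, (∑ y, M x y) * f x) ^ 2 / ∑ x, ∑ y, M x y := by
  classical
  set p : ι → ℝ := fun x => ∑ y, M x y with hp
  have hp0 : ∀ x, 0 ≤ p x := fun x => Finset.sum_nonneg fun y _ => hnn x y
  have hM0 : ∀ x y, p x = 0 → M x y = 0 := fun x y h =>
    (Finset.sum_eq_zero_iff_of_nonneg fun y _ => hnn x y).1 h y (Finset.mem_univ y)
  have hM0' : ∀ x y, p y = 0 → M x y = 0 := fun x y h => by rw [hsymm]; exact hM0 y x h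
  set s : ι → ℝ := fun x => √(p x) with hs
  have hss : ∀ x, s x * s x = p x := fun x => Real.mul_self_sqrt (hp0 x)
  have hs0 : ∀ x, s x = 0 ↔ p x = 0 := fun x => Real.sqrt_eq_zero (hp0 x)
  set P : ℝ := ∑ x, p x with hP
  -- `B` is the symmetrically normalized form of the random walk, with `B s = s`.
  set B : ι → ι → ℝ := fun x y => M x y / (s x * s y) with hB
  have hBs : ∀ x y, s x * B x y * s y = M x y := by
    intro x y
    by_cases hx : p x = 0
    · simp [hB, hM0 x y hx]
    by_cases hy : p y = 0
    · simp [hB, hM0' x y hy]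
    have hx' := mt (hs0 x).1 hx
    have hy' := mt (hs0 y).1 hy
    simp only [hB]
    field_simp
  have hBs' : ∀ x y, B x y * s y = M x y / s x := by
    intro x y
    by_cases hy : p y = 0
    · simp [hB, hM0' x y hy]
    have hy' := mt (hs0 y).1 hy
    simp only [hB]
    field_simp
  have hBsum : ∀ x, ∑ y, B x y * s y = s x := by
    intro x
    simp only [hBs', ← Finset.sum_div]
    change p x / s x = s x
    rw [← hss]
    by_cases hx : s x = 0
    · simp [hx]
    · field_simp
  have hBsymm : ∀ x y, B x y = B y x := fun x y => by simp only [hB]; rw [hsymm, mul_comm (s x)]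
  have hBsum' : ∀ y, ∑ x, s x * B x y = s y := by
    intro y
    rw [← hBsum y]
    exact Finset.sum_congr rfl fun x _ => by rw [hBsymm, mul_comm]
  by_cases hPz : P = 0
  · have hz : ∀ x, p x = 0 := fun x =>
      (Finset.sum_eq_zero_iff_of_nonneg fun y _ => hp0 y).1 hPz x (Finset.mem_univ x)
    simp [hM0 _ _ (hz _)]
  have hsP : ∑ x, s x * s x = P := Finset.sum_congr rfl fun x _ => hss x
  -- It suffices that the symmetric matrix `N`, which kills `s`, be positive semidefinite.
  set N : Matrix ι ι ℝ := Matrix.of fun x y =>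
    (if x = y then lam else 0) - B x y + (1 - lam) * (s x * s y) / P with hN
  have hNmul : ∀ (g : ι → ℝ) x, (N *ᵥ g) x =
      lam * g x - ∑ y, B x y * g y + (1 - lam) * s x * (∑ y, s y * g y) / P := by
    intro g x
    have hterm : ∀ y, N x y * g y = (if x = y then lam * g y else 0) - B x y * g y
        + (1 - lam) * s x / P * (s y * g y) := by
      intro y
      simp only [hN, Matrix.of_apply]
      split_ifs <;> ring
    simp only [Matrix.mulVec, dotProduct, hterm, Finset.sum_add_distrib, Finset.sum_sub_distrib,
      ← Finset.mul_sum, Finset.sum_ite_eq, Finset.mem_univ, if_true]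
    ring
  have hherm : N.IsHermitian := by
    ext x y
    simp only [hN, Matrix.conjTranspose_apply, Matrix.of_apply, star_trivial, hBsymm y x,
      mul_comm (s y), eq_comm (a := y)]
  have hpsd : N.PosSemidef := by
    rw [hherm.posSemidef_iff_eigenvalues_nonneg]
    intro j
    have hj := hherm.mulVec_eigenvectorBasis j
    have hj0 : (hherm.eigenvectorBasis j).ofLp ≠ 0 := fun h =>
      hherm.eigenvectorBasis.toBasis.ne_zero j (by
        rw [OrthonormalBasis.coe_toBasis]
        exact (WithLp.ofLp_eq_zero 2).1 h)
    generalize (hherm.eigenvectorBasis j).ofLp = g at hj hj0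
    change 0 ≤ hherm.eigenvalues j
    generalize hherm.eigenvalues j = ν at hj
    by_contra! hν
    have hrow : ∀ x, lam * g x - ∑ y, B x y * g y + (1 - lam) * s x * (∑ y, s y * g y) / P
        = ν * g x := fun x => by
      rw [← hNmul, hj]; rfl
    have horth : ∑ x, s x * g x = 0 := by
      have h1 : ∑ x, s x * (ν * g x) = 0 := by
        simp only [← hrow]
        have h2 : ∑ x, s x * ∑ y, B x y * g y = ∑ y, s y * g y := by
          simp only [Finset.mul_sum]
          rw [Finset.sum_comm]
          refine Finset.sum_congr rfl fun y _ => ?_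
          rw [← hBsum' y, Finset.sum_mul]
          exact Finset.sum_congr rfl fun x _ => by ring
        have h4 : ∀ G : ℝ,
            ∑ x, s x * (lam * g x - ∑ y, B x y * g y + (1 - lam) * s x * G / P)
              = lam * ∑ x, s x * g x - ∑ x, s x * ∑ y, B x y * g y
                + (∑ x, s x * s x) * ((1 - lam) * G / P) := by
          intro G
          rw [Finset.mul_sum, ← Finset.sum_sub_distrib, Finset.sum_mul, ← Finset.sum_add_distrib]
          exact Finset.sum_congr rfl fun x _ => by ring
        rw [h4, h2, hsP]
        field_simp
        ring
      have h3 : ν * ∑ x, s x * g x = 0 := by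
        rw [← h1, Finset.mul_sum]
        exact Finset.sum_congr rfl fun x _ => by ring
      exact (mul_eq_zero.1 h3).resolve_left hν.ne
    have hrow' : ∀ x, ∑ y, B x y * g y = (lam - ν) * g x := fun x => by
      have := hrow x
      rw [horth] at this
      simp only [mul_zero, zero_div, add_zero] at this
      linarith
    have hg0 : ∀ x, p x = 0 → g x = 0 := by
      intro x hx
      have h := hrow' x
      simp only [hB, hM0 x _ hx, zero_div, zero_mul, Finset.sum_const_zero] at h
      have : lam - ν ≠ 0 := by linarith
      exact (mul_eq_zero.1 h.symm).resolve_left this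
    have hsg : ∀ x, s x * (g x / s x) = g x := by
      intro x
      by_cases hx : p x = 0
      · simp [hg0 x hx]
      · have hx' := mt (hs0 x).1 hx
        field_simp
    have hle : lam - ν ≤ lam := by
      refine hev (lam - ν) (fun x => g x / s x) ?_ ?_ ?_
      · rw [← horth]
        refine Finset.sum_congr rfl fun x _ => ?_
        rw [← hsg x]
        change p x * _ = _
        rw [← hss]
        rw [hsg]
        rw [mul_assoc, hsg]
      · obtain ⟨x, hx⟩ := Function.ne_iff.1 hj0
        have hpx : p x ≠ 0 := fun h => hx (hg0 x h)
        exact ⟨x, hpx, div_ne_zero hx (mt (hs0 x).1 hpx)⟩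
      · intro x
        change _ = _ * p x * _
        calc ∑ y, M x y * (g y / s y) = ∑ y, s x * (B x y * g y) :=
              Finset.sum_congr rfl fun y _ => by rw [← hBs, mul_assoc, hsg, mul_assoc]
          _ = s x * ((lam - ν) * g x) := by rw [← Finset.mul_sum, hrow']
          _ = (lam - ν) * p x * (g x / s x) := by
              rw [← hss]
              linear_combination (-(lam - ν) * s x) * hsg x
    linarith
  have h0 := hpsd.dotProduct_mulVec_nonneg (fun x => s x * f x)
  have hexp : star (fun x => s x * f x) ⬝ᵥ (N *ᵥ fun x => s x * f x) =
      lam * ∑ x, p x * f x ^ 2 - ∑ x, ∑ y, M x y * f x * f y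
        + (1 - lam) * (∑ x, p x * f x) ^ 2 / P := by
    have e1 : ∑ y, s y * (s y * f y) = ∑ y, p y * f y :=
      Finset.sum_congr rfl fun y _ => by rw [← hss]; ring
    simp only [dotProduct, hNmul, star_trivial, e1]
    calc ∑ x, s x * f x * (lam * (s x * f x) - ∑ y, B x y * (s y * f y)
          + (1 - lam) * s x * (∑ y, p y * f y) / P)
        = ∑ x, (lam * (p x * f x ^ 2) - ∑ y, M x y * f x * f y
          + (p x * f x) * ((1 - lam) * (∑ y, p y * f y) / P)) := by
          refine Finset.sum_congr rfl fun x _ => ?_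
          have : s x * f x * ∑ y, B x y * (s y * f y) = ∑ y, M x y * f x * f y := by
            rw [Finset.mul_sum]
            refine Finset.sum_congr rfl fun y _ => ?_
            rw [← hBs]
            ring
          rw [← this, ← hss]
          ring
      _ = _ := by
          rw [Finset.sum_add_distrib, Finset.sum_sub_distrib, ← Finset.mul_sum, ← Finset.sum_mul]
          ring
  rw [hexp] at h0
  linarith

end SheafCode

/-! ### Weights on triangles and the trickling-down theorem -/

namespace SheafCode

/-- A symmetric nonnegative weight on the ordered triples of vertices. For a pure complex, the
weight of `(a, b, c)` is to be the number of top-dimensional faces containing the triangle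
`{a, b, c}`, and zero if two of the vertices agree. -/
structure TriangleWeight (V : Type*) where
  w : V → V → V → ℝ
  nonneg : ∀ a b c, 0 ≤ w a b c
  swap_left : ∀ a b c, w a b c = w b a c
  swap_right : ∀ a b c, w a b c = w a c b

namespace TriangleWeight

variable {V : Type*} [Fintype V] (T : TriangleWeight V)

/-- The induced weight on pairs of vertices. -/
def edge (a b : V) : ℝ := ∑ c, T.w a b c

/-- The induced weight on vertices. -/
def vertex (a : V) : ℝ := ∑ b, T.edge a b

/-- The quadratic-form version of the condition that all links be `[-1, lam]`-spectral
expanders. -/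
def LinkGap (lam : ℝ) : Prop :=
  ∀ (a : V) (f : V → ℝ), ∑ b, ∑ c, T.w a b c * f b * f c ≤
    lam * ∑ b, T.edge a b * f b ^ 2 + (1 - lam) * (∑ b, T.edge a b * f b) ^ 2 / T.vertex a

/-- The quadratic-form version of the condition that the underlying weighted graph be a
`[-1, lam]`-spectral expander. -/
def GraphGap (lam : ℝ) : Prop :=
  ∀ f : V → ℝ, ∑ a, ∑ b, T.edge a b * f a * f b ≤
    lam * ∑ a, T.vertex a * f a ^ 2 + (1 - lam) * (∑ a, T.vertex a * f a) ^ 2 / ∑ a, T.vertex a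

theorem edge_nonneg (a b : V) : 0 ≤ T.edge a b := Finset.sum_nonneg fun c _ => T.nonneg a b c

theorem edge_comm (a b : V) : T.edge a b = T.edge b a :=
  Finset.sum_congr rfl fun c _ => T.swap_left a b c

theorem vertex_nonneg (a : V) : 0 ≤ T.vertex a := Finset.sum_nonneg fun b _ => T.edge_nonneg a b

theorem sum_edge_mul_left (f : V → ℝ) : ∑ a, ∑ b, T.edge a b * f a = ∑ a, T.vertex a * f a :=
  Finset.sum_congr rfl fun a _ => by rw [vertex, Finset.sum_mul]

theorem sum_edge_mul_right (f : V → ℝ) : ∑ a, ∑ b, T.edge a b * f b = ∑ a, T.vertex a * f a := by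
  rw [Finset.sum_comm, ← sum_edge_mul_left]
  exact Finset.sum_congr rfl fun a _ => Finset.sum_congr rfl fun b _ => by rw [T.edge_comm]

/-- Averaging a quadratic form over the links gives the quadratic form of the graph. -/
theorem sum_link_quadForm (f : V → ℝ) :
    ∑ a, ∑ b, ∑ c, T.w a b c * f b * f c = ∑ a, ∑ b, T.edge a b * f a * f b := by
  rw [Finset.sum_comm]
  refine Finset.sum_congr rfl fun b _ => ?_
  rw [Finset.sum_comm]
  refine Finset.sum_congr rfl fun c _ => ?_
  rw [edge, Finset.sum_mul, Finset.sum_mul]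
  exact Finset.sum_congr rfl fun a _ => by rw [T.swap_left a b c, T.swap_right b a c]

/-- Oppenheim's trickling-down theorem: in a connected complex, a spectral gap in all links implies
one in the underlying graph. An eigenvalue `μ` of the graph satisfies `μ ≤ lam + (1 - lam) μ²`,
which excludes the open interval between `lam / (1 - lam)` and `1`. -/
theorem LinkGap.graphGap {T : TriangleWeight V} {lam : ℝ} (h0 : 0 ≤ lam) (h1 : lam < 1)
    (hT : T.LinkGap lam)
    (hconn : ∀ f : V → ℝ, (∀ a b, T.edge a b ≠ 0 → f a = f b) → ∀ a b, f a = f b) :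
    T.GraphGap (lam / (1 - lam)) := by
  have h1' : 0 < 1 - lam := by linarith
  refine quadForm_le_of_eigenvalue_le T.edge T.edge_comm T.edge_nonneg (by positivity) ?_
  intro μ f hmean hne heig
  change ∑ a, T.vertex a * f a = 0 at hmean
  change ∀ a, ∑ b, T.edge a b * f b = μ * T.vertex a * f a at heig
  obtain ⟨x, hx, hfx⟩ := hne
  change T.vertex x ≠ 0 at hx
  set N := ∑ a, T.vertex a * f a ^ 2 with hN
  have hterm : ∀ a, 0 ≤ T.vertex a * f a ^ 2 := fun a => mul_nonneg (T.vertex_nonneg a) (sq_nonneg _)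
  have hNpos : 0 < N := Finset.sum_pos' (fun a _ => hterm a) ⟨x, Finset.mem_univ x,
    lt_of_le_of_ne (hterm x) (Ne.symm (mul_ne_zero hx (pow_ne_zero 2 hfx)))⟩
  have hquad : ∑ a, ∑ b, T.edge a b * f a * f b = μ * N := by
    rw [hN, Finset.mul_sum]
    refine Finset.sum_congr rfl fun a _ => ?_
    have : ∑ b, T.edge a b * f a * f b = f a * ∑ b, T.edge a b * f b := by
      rw [Finset.mul_sum]
      exact Finset.sum_congr rfl fun b _ => by ring
    rw [this, heig]
    ring
  -- The eigenvalue is less than `1`, as the graph is connected.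
  have hdiff : ∑ a, ∑ b, T.edge a b * (f a - f b) ^ 2 = 2 * (1 - μ) * N := by
    have e : ∀ a b, T.edge a b * (f a - f b) ^ 2 =
        T.edge a b * f a ^ 2 + T.edge a b * f b ^ 2 - 2 * (T.edge a b * f a * f b) :=
      fun a b => by ring
    simp only [e, Finset.sum_sub_distrib, Finset.sum_add_distrib, ← Finset.mul_sum]
    rw [T.sum_edge_mul_left fun a => f a ^ 2, T.sum_edge_mul_right fun a => f a ^ 2, hquad]
    ring
  have hdnn : ∀ a b, 0 ≤ T.edge a b * (f a - f b) ^ 2 :=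
    fun a b => mul_nonneg (T.edge_nonneg a b) (sq_nonneg _)
  have hμ1 : μ < 1 := by
    have hle : 0 ≤ 2 * (1 - μ) * N := by
      rw [← hdiff]
      exact Finset.sum_nonneg fun a _ => Finset.sum_nonneg fun b _ => hdnn a b
    have hle' : μ ≤ 1 := by
      by_contra! h
      nlinarith
    refine lt_of_le_of_ne hle' fun h => ?_
    rw [h] at hdiff
    norm_num at hdiff
    have hconst := hconn f fun a b hab => by
      have h2 := (Finset.sum_eq_zero_iff_of_nonneg fun a _ =>
        Finset.sum_nonneg fun b _ => hdnn a b).1 hdiff a (Finset.mem_univ a)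
      have h3 := (Finset.sum_eq_zero_iff_of_nonneg fun b _ => hdnn a b).1 h2 b (Finset.mem_univ b)
      have h4 := (mul_eq_zero.1 h3).resolve_left hab
      exact sub_eq_zero.1 (pow_eq_zero_iff two_ne_zero |>.1 h4)
    have : N = f x * ∑ a, T.vertex a * f a := by
      rw [hN, Finset.mul_sum]
      exact Finset.sum_congr rfl fun a _ => by rw [hconst x a]; ring
    rw [hmean, mul_zero] at this
    exact hNpos.ne' this
  have htrickle : μ * N ≤ lam * N + (1 - lam) * μ ^ 2 * N := by
    rw [← hquad, ← T.sum_link_quadForm]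
    refine (Finset.sum_le_sum fun a _ => hT a f).trans (le_of_eq ?_)
    rw [Finset.sum_add_distrib, ← Finset.mul_sum, T.sum_edge_mul_right fun a => f a ^ 2]
    congr 1
    rw [hN, Finset.mul_sum]
    refine Finset.sum_congr rfl fun a _ => ?_
    rw [heig]
    by_cases ha : T.vertex a = 0
    · simp [ha]
    · field_simp
  have hfac : 0 ≤ (1 - μ) * (lam - (1 - lam) * μ) := by
    by_contra! h
    nlinarith
  rw [le_div_iff₀ h1']
  nlinarith [nonneg_of_mul_nonneg_right hfac (by linarith : 0 < 1 - μ)]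

end TriangleWeight

end SheafCode

/-! ### Sparse supports of cocycles vanish -/

namespace SheafCode

namespace TriangleWeight

variable {V : Type*} [Fintype V] {T : TriangleWeight V}

/-- If the vertices of a link are labelled and no label class has more than the fraction `1 - ρ` of
the total weight, then the weight of the pairs with equal labels is bounded away from the total
weight. Only the vertices in `s` are taken into account. -/
theorem LinkGap.monochromatic_le {lam ρ : ℝ} (h1 : lam ≤ 1)
    (hT : T.LinkGap lam) (v : V) (s : V → Prop) [DecidablePred s] {L : Type*} [DecidableEq L]
    (c : V → L)
    (hc : ∀ g, (∑ a, T.edge v a * if s a ∧ c a = g then 1 else 0) ≤ (1 - ρ) * T.vertex v) :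
    (∑ a, ∑ b, T.w v a b * if s a ∧ s b ∧ c a = c b then 1 else 0) ≤
      (1 - ρ * (1 - lam)) * ∑ a, T.edge v a * if s a then 1 else 0 := by
  set I : Finset L := Finset.univ.image c with hI
  have hmem : ∀ a, c a ∈ I := fun a => Finset.mem_image_of_mem c (Finset.mem_univ a)
  set β : L → ℝ := fun g => ∑ a, T.edge v a * if s a ∧ c a = g then 1 else 0 with hβ
  have hβ0 : ∀ g, 0 ≤ β g := fun g => Finset.sum_nonneg fun a _ =>
    mul_nonneg (T.edge_nonneg v a) (by split_ifs <;> norm_num)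
  have hβsum : ∑ g ∈ I, β g = ∑ a, T.edge v a * if s a then 1 else 0 := by
    simp only [hβ]
    rw [Finset.sum_comm]
    refine Finset.sum_congr rfl fun a _ => ?_
    rw [← Finset.mul_sum]
    by_cases ha : s a <;> simp [ha, hmem]
  have hclass : ∀ g, (∑ a, ∑ b, T.w v a b * (if s a ∧ c a = g then 1 else 0) *
      (if s b ∧ c b = g then 1 else 0)) ≤ (1 - ρ * (1 - lam)) * β g := by
    intro g
    refine (hT v fun a => if s a ∧ c a = g then 1 else 0).trans ?_
    have e : ∀ a, T.edge v a * (if s a ∧ c a = g then (1 : ℝ) else 0) ^ 2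
        = T.edge v a * (if s a ∧ c a = g then 1 else 0) := fun a => by split_ifs <;> norm_num
    simp only [e]
    change lam * β g + (1 - lam) * β g ^ 2 / T.vertex v ≤ _
    have hdiv : β g ^ 2 / T.vertex v ≤ (1 - ρ) * β g := by
      rcases (T.vertex_nonneg v).eq_or_lt with h | h
      · have hz : β g = 0 := le_antisymm (by simpa only [← h, mul_zero] using hc g) (hβ0 g)
        simp [hz]
      · rw [div_le_iff₀ h]
        nlinarith [hβ0 g, hc g]
    rw [mul_div_assoc]
    nlinarith [mul_le_mul_of_nonneg_left hdiv (by linarith : 0 ≤ 1 - lam)]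
  rw [← hβsum, Finset.mul_sum]
  refine le_trans (le_of_eq ?_) (Finset.sum_le_sum fun g _ => hclass g)
  rw [Finset.sum_comm (s := I)]
  refine Finset.sum_congr rfl fun a _ => ?_
  rw [Finset.sum_comm (s := I)]
  refine Finset.sum_congr rfl fun b _ => ?_
  simp only [mul_assoc, ← Finset.mul_sum]
  congr 1
  by_cases ha : s a <;> by_cases hb : s b <;> simp [ha, hb, hmem, eq_comm]

/-- The numerical contradiction between the local bound `hlocal` and the bound `hmix` from the mixing
lemma, where `Θ` and `Φ` are the weights of the support at thin and at fat vertices. -/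
theorem eq_zero_of_thin_fat_bounds {lam h q Θ Φ : ℝ} (h0 : 0 ≤ lam) (hh : 0 < h) (hq1 : q ≤ 1)
    (hhq : 4 * (lam + h) ≤ q) (hΘ0 : 0 ≤ Θ) (hΦ0 : 0 ≤ Φ)
    (hlocal : (1 - lam - (1 - lam) * h) * Θ ≤ (lam + (1 - lam) * h) * Θ + (1 - q) * Φ)
    (hmix : Φ ≤ Θ + h / 3 * Φ) : Θ + Φ = 0 := by
  have i0 := mul_nonneg (mul_nonneg h0 hh.le) hΘ0
  have i1 : (1 - 2 * lam - 2 * h) * Θ ≤ (1 - 4 * lam - 4 * h) * Φ := by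
    linarith [mul_le_mul_of_nonneg_right hhq hΦ0]
  have i2 : (1 - 2 * lam - 2 * h) * ((1 - h / 3) * Φ) ≤ (1 - 2 * lam - 2 * h) * Θ :=
    mul_le_mul_of_nonneg_left (by linarith) (by linarith)
  have i3 : h * Φ ≤ 0 := by
    linarith [mul_nonneg (mul_nonneg h0 hh.le) hΦ0, mul_nonneg h0 hΦ0,
      mul_nonneg (mul_nonneg hh.le hh.le) hΦ0, mul_nonneg hh.le hΦ0]
  have hΦz : Φ = 0 := le_antisymm (nonpos_of_mul_nonpos_right i3 hh) hΦ0
  subst hΦz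
  have hΘz : Θ = 0 := by
    refine le_antisymm (nonpos_of_mul_nonpos_right (a := 1 - 2 * lam - 2 * h) ?_ ?_) hΘ0 <;>
      linarith
  rw [hΘz, add_zero]

/-- A relation `s` between vertices that meets every triangle in `0`, `2` or `3` edges (like the
support of a `1`-cocycle) is empty if it is sparse and, in every link, the label classes of `s` are
not too heavy. Pairs of edges of `s` at a vertex that lie in a triangle whose third edge is not in
`s` have the same label.

A vertex is called fat if more than the fraction `h` of the edges at it are in `s`. There are few fat
vertices, so by the expander mixing lemma most edges of `s` have a thin end. At a thin vertex
most triangles with one edge in `s` have exactly one edge in `s` at that vertex; each of them has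
its second edge in `s` opposite to it, and is seen from a third vertex as a pair of edges in `s`
with the same label. But there are too few such pairs. -/
theorem LinkGap.sum_edge_support_eq_zero {lam ρ h : ℝ} (h0 : 0 ≤ lam) (h1 : lam < 1)
    (hρ1 : ρ ≤ 1) (hh : 0 < h) (hh2 : lam / (1 - lam) ≤ h ^ 2 / 6)
    (hhρ : 4 * (lam + h) ≤ ρ * (1 - lam)) (hT : T.LinkGap lam)
    (hG : T.GraphGap (lam / (1 - lam))) (s : V → V → Prop) [DecidableRel s]
    (hs : ∀ a b, s a b ↔ s b a)
    (hcoc : ∀ a b c, T.w a b c ≠ 0 → s a b → ¬ s a c → s b c)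
    {L : V → Type*} (l : ∀ v, V → L v)
    (hl : ∀ v a b, T.w v a b ≠ 0 → s v a → s v b → ¬ s a b → l v a = l v b)
    (hclass : ∀ v (g : L v), (∑ a, open Classical in
      T.edge v a * if s v a ∧ l v a = g then 1 else 0) ≤ (1 - ρ) * T.vertex v)
    (hsmall : (∑ v, ∑ a, T.edge v a * if s v a then 1 else 0) ≤ h ^ 3 / 6 * ∑ v, T.vertex v) :
    (∑ v, ∑ a, T.edge v a * if s v a then 1 else 0) = 0 := by
  classical
  have h1' : 0 < 1 - lam := by linarith
  set χ : V → V → ℝ := fun a b => if s a b then 1 else 0 with hχ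
  have hχ0 : ∀ a b, 0 ≤ χ a b := fun a b => by simp only [hχ]; split_ifs <;> norm_num
  have hχ1 : ∀ a b, χ a b ≤ 1 := fun a b => by simp only [hχ]; split_ifs <;> norm_num
  have hχs : ∀ a b, χ a b = χ b a := fun a b => by simp only [hχ, hs a b]
  set α : V → ℝ := fun v => ∑ a, T.edge v a * χ v a with hα
  have hα0 : ∀ v, 0 ≤ α v := fun v => Finset.sum_nonneg fun a _ =>
    mul_nonneg (T.edge_nonneg v a) (hχ0 v a)
  -- The weights of the pairs of edges at `v` that are both in `s`, that are both in `s` with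
  -- opposite edge not in `s`, and of which just the first is in `s`.
  set A : V → ℝ := fun v => ∑ a, ∑ b, T.w v a b * χ v a * χ v b with hA
  set E : V → ℝ := fun v => ∑ a, ∑ b, T.w v a b * (χ v a * χ v b * (1 - χ a b)) with hE
  set Y : V → ℝ := fun v => ∑ a, ∑ b, T.w v a b * (χ v a * (1 - χ v b)) with hY
  have hYA : ∀ v, Y v = α v - A v := by
    intro v
    simp only [hY, hα, hA, TriangleWeight.edge, Finset.sum_mul, ← Finset.sum_sub_distrib]
    exact Finset.sum_congr rfl fun a _ => Finset.sum_congr rfl fun b _ => by ring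
  have hY0 : ∀ v, 0 ≤ Y v := fun v => Finset.sum_nonneg fun a _ => Finset.sum_nonneg fun b _ =>
    mul_nonneg (T.nonneg v a b) (mul_nonneg (hχ0 v a) (by linarith [hχ1 v b]))
  have hEA : ∀ v, E v ≤ A v := by
    intro v
    refine Finset.sum_le_sum fun a _ => Finset.sum_le_sum fun b _ => ?_
    rw [mul_assoc (T.w v a b)]
    refine mul_le_mul_of_nonneg_left ?_ (T.nonneg v a b)
    exact mul_le_of_le_one_right (mul_nonneg (hχ0 v a) (hχ0 v b)) (by linarith [hχ0 a b])
  -- Every triangle with exactly two edges in `s` is counted twice on either side.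
  have hEY : ∑ v, E v = ∑ v, Y v := by
    have e : ∀ v a b, T.w v a b * (χ v a * (1 - χ v b))
        = T.w a v b * (χ a v * χ a b * (1 - χ v b)) := by
      intro v a b
      rw [T.swap_left a v b, hχs a v]
      by_cases hw : T.w v a b = 0
      · simp [hw]
      by_cases hva : s v a
      · by_cases hvb : s v b
        · simp [hχ, hvb]
        · simp [hχ, hva, hvb, hcoc v a b hw hva hvb]
      · simp [hχ, hva]
    simp only [hE, hY, e]
    exact Finset.sum_comm
  have hAthin : ∀ v, α v ≤ h * T.vertex v → A v ≤ (lam + (1 - lam) * h) * α v := by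
    intro v hv
    refine (hT v (χ v)).trans ?_
    have e : ∀ a, T.edge v a * χ v a ^ 2 = T.edge v a * χ v a := fun a => by
      simp only [hχ]; split_ifs <;> norm_num
    simp only [e]
    change lam * α v + (1 - lam) * α v ^ 2 / T.vertex v ≤ _
    have hdiv : α v ^ 2 / T.vertex v ≤ h * α v := by
      rcases (T.vertex_nonneg v).eq_or_lt with h' | h'
      · have hz : α v = 0 := le_antisymm (by simpa [← h'] using hv) (hα0 v)
        simp [hz]
      · rw [div_le_iff₀ h']
        nlinarith [hα0 v]
    rw [mul_div_assoc]
    nlinarith [mul_le_mul_of_nonneg_left hdiv h1'.le]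
  have hEall : ∀ v, E v ≤ (1 - ρ * (1 - lam)) * α v := by
    intro v
    refine le_trans ?_ (hT.monochromatic_le (ρ := ρ) h1.le v (s v) (l v) (hclass v))
    refine Finset.sum_le_sum fun a _ => Finset.sum_le_sum fun b _ => ?_
    by_cases hw : T.w v a b = 0
    · simp [hw]
    refine mul_le_mul_of_nonneg_left ?_ (T.nonneg v a b)
    by_cases hva : s v a <;> by_cases hvb : s v b <;> by_cases hab : s a b <;>
      simp [hχ, hva, hvb, hab]
    · split_ifs <;> norm_num
    · simp [hl v a b hw hva hvb hab]
  set fat : V → Prop := fun v => h * T.vertex v < α v with hfat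
  set Φ : ℝ := ∑ v, if fat v then α v else 0 with hΦ
  set Θ : ℝ := ∑ v, if fat v then 0 else α v with hΘ
  have hΦ0 : 0 ≤ Φ := Finset.sum_nonneg fun v _ => by split_ifs <;> simp [hα0 v]
  have hΘ0 : 0 ≤ Θ := Finset.sum_nonneg fun v _ => by split_ifs <;> simp [hα0 v]
  have hsum : ∑ v, α v = Θ + Φ := by
    rw [hΘ, hΦ, ← Finset.sum_add_distrib]
    exact Finset.sum_congr rfl fun v _ => by split_ifs <;> simp
  change ∑ v, α v ≤ _ at hsmall
  change ∑ v, α v = 0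
  have hlocal : (1 - lam - (1 - lam) * h) * Θ ≤
      (lam + (1 - lam) * h) * Θ + (1 - ρ * (1 - lam)) * Φ := by
    calc (1 - lam - (1 - lam) * h) * Θ ≤ ∑ v, Y v := by
          rw [hΘ, Finset.mul_sum]
          refine Finset.sum_le_sum fun v _ => ?_
          split_ifs with hv
          · simpa using hY0 v
          · rw [hYA]
            linarith [hAthin v (not_lt.1 hv)]
      _ = ∑ v, E v := hEY.symm
      _ ≤ _ := by
          rw [hΘ, hΦ, Finset.mul_sum, Finset.mul_sum, ← Finset.sum_add_distrib]
          refine Finset.sum_le_sum fun v _ => ?_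
          split_ifs with hv
          · simpa using hEall v
          · simpa using (hEA v).trans (hAthin v (not_lt.1 hv))
  -- The total weight `Pf` of the fat vertices is small, by Markov's inequality.
  set P : ℝ := ∑ v, T.vertex v with hP
  set φ : V → ℝ := fun v => if fat v then 1 else 0 with hφ
  set Pf : ℝ := ∑ v, T.vertex v * φ v with hPf
  have hPf0 : 0 ≤ Pf := Finset.sum_nonneg fun v _ =>
    mul_nonneg (T.vertex_nonneg v) (by simp only [hφ]; split_ifs <;> norm_num)
  have hPfΦ : h * Pf ≤ Φ := by
    rw [hPf, hΦ, Finset.mul_sum]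
    refine Finset.sum_le_sum fun v _ => ?_
    simp only [hφ]
    split_ifs with hv
    · simpa using hv.le
    · simp
  have hP0 : 0 ≤ P := Finset.sum_nonneg fun v _ => T.vertex_nonneg v
  have hPfP : Pf ≤ h ^ 2 / 6 * P := by
    have : h * Pf ≤ h * (h ^ 2 / 6 * P) := by nlinarith
    exact le_of_mul_le_mul_left this hh
  have hmix : Φ ≤ Θ + h / 3 * Φ := by
    have hff : ∑ a, ∑ b, T.edge a b * φ a * φ b ≤ h ^ 2 / 3 * Pf := by
      refine (hG φ).trans ?_
      have e : ∀ a, T.vertex a * φ a ^ 2 = T.vertex a * φ a := fun a => by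
        simp only [hφ]; split_ifs <;> norm_num
      simp only [e]
      change lam / (1 - lam) * Pf + (1 - lam / (1 - lam)) * Pf ^ 2 / P ≤ _
      have hdiv : Pf ^ 2 / P ≤ h ^ 2 / 6 * Pf := by
        rcases hP0.eq_or_lt with h' | h'
        · rw [← h', div_zero]
          positivity
        · rw [div_le_iff₀ h']
          nlinarith
      have hq : 0 ≤ lam / (1 - lam) := by positivity
      have hd0 : 0 ≤ Pf ^ 2 / P := by positivity
      rw [mul_div_assoc]
      nlinarith [mul_le_mul_of_nonneg_right hh2 hPf0, mul_nonneg hq hd0]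
    have hsplit : Φ ≤ ∑ a, ∑ b, T.edge a b * φ a * φ b + Θ := by
      have e1 : Θ = ∑ a, ∑ b, T.edge a b * χ a b * (1 - φ b) := by
        rw [hΘ, Finset.sum_comm]
        refine Finset.sum_congr rfl fun b _ => ?_
        rw [← Finset.sum_mul]
        have : ∑ a, T.edge a b * χ a b = α b :=
          Finset.sum_congr rfl fun a _ => by rw [T.edge_comm, hχs]
        rw [this]
        simp only [hφ]
        split_ifs <;> simp
      have e2 : Φ = ∑ a, ∑ b, T.edge a b * χ a b * φ a := by
        rw [hΦ]
        refine Finset.sum_congr rfl fun a _ => ?_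
        rw [← Finset.sum_mul]
        simp only [hφ]
        change _ = α a * _
        split_ifs <;> simp
      rw [e1, e2, ← Finset.sum_add_distrib]
      refine Finset.sum_le_sum fun a _ => ?_
      rw [← Finset.sum_add_distrib]
      refine Finset.sum_le_sum fun b _ => ?_
      have hab := T.edge_nonneg a b
      simp only [hφ, hχ]
      split_ifs <;> simp [hab]
    have : h ^ 2 / 3 * Pf ≤ h / 3 * Φ := by nlinarith
    linarith
  rw [hsum]
  exact eq_zero_of_thin_fat_bounds h0 hh (by nlinarith) hhρ hΘ0 hΦ0 hlocal hmix

end TriangleWeight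

end SheafCode

/-! ### The triangle weight of a pure complex -/

namespace SheafCode

section FaceCount

variable {V : Type u} [Fintype V] [DecidableEq V]

/-- The number of `d`-faces containing `x`. For pure complexes of dimension `d`, the canonical weight
is proportional to it on faces of equal dimension. -/
noncomputable def faceCount (K : PreAbstractSimplicialComplex V) (d : ℕ) (x : Finset V) : ℕ :=
  ((kFaces K d).filter fun y => x ⊆ y).card

theorem weight_eq_faceCount_div (K : PreAbstractSimplicialComplex V) (d : ℕ) (x : Finset V) :
    weight K d x = (faceCount K d x : ℝ) / (((d + 1).choose x.card : ℝ) * ((kFaces K d).card : ℝ)) :=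
  rfl

theorem faceCount_le_card_kFaces (K : PreAbstractSimplicialComplex V) (d : ℕ) (x : Finset V) :
    faceCount K d x ≤ (kFaces K d).card :=
  Finset.card_filter_le _ _

theorem faceCount_anti (K : PreAbstractSimplicialComplex V) (d : ℕ) {x y : Finset V} (h : x ⊆ y) :
    faceCount K d y ≤ faceCount K d x :=
  Finset.card_le_card (Finset.monotone_filter_right _ fun _ _ hz => h.trans hz)

theorem IsPure.faceCount_pos {K : PreAbstractSimplicialComplex V} {d : ℕ} (hK : IsPure K d)
    {x : Finset V} (hx : x ∈ K) : 0 < faceCount K d x := by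
  obtain ⟨y, hy, hxy⟩ := hK.2 x hx
  exact Finset.card_pos.2 ⟨y, Finset.mem_filter.2 ⟨hy, hxy⟩⟩

theorem mem_of_faceCount_ne_zero {K : PreAbstractSimplicialComplex V} {d : ℕ} {x : Finset V}
    (hx : x.Nonempty) (h : faceCount K d x ≠ 0) : x ∈ K := by
  obtain ⟨y, hy⟩ := Finset.card_ne_zero.1 h
  rw [Finset.mem_filter, mem_kFaces] at hy
  exact (K.isRelLowerSet_faces hy.1.1).2 hy.2 hx

theorem sum_faceCount_insert (K : PreAbstractSimplicialComplex V) (d : ℕ) (x : Finset V) :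
    ∑ c, (if c ∈ x then 0 else (faceCount K d (insert c x) : ℝ)) =
      ((d : ℝ) + 1 - x.card) * faceCount K d x := by
  have e : ∀ c, (if c ∈ x then 0 else (faceCount K d (insert c x) : ℝ)) =
      ∑ y ∈ kFaces K d, if x ⊆ y then (if c ∈ y \ x then 1 else 0) else (0 : ℝ) := by
    intro c
    by_cases hc : c ∈ x
    · simp [hc]
    · simp only [hc, if_false, faceCount, Finset.card_filter, Nat.cast_sum]
      refine Finset.sum_congr rfl fun y _ => ?_
      by_cases hx : x ⊆ y <;> by_cases hcy : c ∈ y <;> simp [Finset.insert_subset_iff, hx, hcy, hc]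
  simp only [e]
  rw [Finset.sum_comm]
  simp only [faceCount, Finset.card_filter, Nat.cast_sum, Finset.mul_sum]
  refine Finset.sum_congr rfl fun y hy => ?_
  by_cases hx : x ⊆ y
  · have hc : ((y \ x).card : ℝ) = (d : ℝ) + 1 - x.card := by
      rw [Finset.cast_card_sdiff hx, (mem_kFaces.1 hy).2]
      push_cast
      ring
    simp only [hx, if_true, Finset.sum_ite_mem, Finset.univ_inter, Finset.sum_const, nsmul_eq_mul,
      mul_one, hc, Nat.cast_one]
  · simp [hx]

/-- The triangle weight that counts the `d`-faces containing a triangle. -/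
noncomputable def triangleWeight (K : PreAbstractSimplicialComplex V) (d : ℕ) :
    TriangleWeight V where
  w a b c := if a ≠ b ∧ a ≠ c ∧ b ≠ c then faceCount K d {a, b, c} else 0
  nonneg a b c := by split_ifs <;> simp
  swap_left a b c := by
    have : ({a, b, c} : Finset V) = {b, a, c} := Finset.insert_comm a b {c}
    rw [this]
    congr 1
    exact propext ⟨fun h => ⟨h.1.symm, h.2.2, h.2.1⟩, fun h => ⟨h.1.symm, h.2.2, h.2.1⟩⟩
  swap_right a b c := by
    rw [Finset.pair_comm b c]
    congr 1
    exact propext ⟨fun h => ⟨h.2.1, h.1, h.2.2.symm⟩, fun h => ⟨h.2.1, h.1, h.2.2.symm⟩⟩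

theorem triangleWeight_w (K : PreAbstractSimplicialComplex V) (d : ℕ) (a b c : V) :
    (triangleWeight K d).w a b c =
      if a ≠ b ∧ a ≠ c ∧ b ≠ c then (faceCount K d {a, b, c} : ℝ) else 0 := rfl

theorem triangleWeight_edge (K : PreAbstractSimplicialComplex V) (d : ℕ) (a b : V) :
    (triangleWeight K d).edge a b =
      if a = b then 0 else ((d : ℝ) - 1) * faceCount K d {a, b} := by
  by_cases hab : a = b
  · simp [TriangleWeight.edge, triangleWeight_w, hab]
  · have h := sum_faceCount_insert K d {a, b}
    rw [Finset.card_pair hab] at h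
    rw [if_neg hab]
    calc (triangleWeight K d).edge a b
        = ∑ c, (if c ∈ ({a, b} : Finset V) then 0 else (faceCount K d (insert c {a, b}) : ℝ)) := by
          refine Finset.sum_congr rfl fun c _ => ?_
          rw [triangleWeight_w]
          have e : ({a, b, c} : Finset V) = insert c {a, b} := by ext; simp; tauto
          rw [e]
          by_cases hca : c = a
          · simp [hca]
          by_cases hcb : c = b
          · simp [hcb]
          simp [hca, hcb, hab, Ne.symm hca, Ne.symm hcb]
      _ = _ := by
          rw [h]
          push_cast
          ring

end FaceCount

section Link

theorem mem_link {V : Type u} [DecidableEq V] {K : PreAbstractSimplicialComplex V}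
    {x z : Finset V} :
    x ∈ link K z ↔ x.Nonempty ∧ Disjoint x z ∧ x ∪ z ∈ K := Iff.rfl

variable {V : Type u} [Fintype V] [DecidableEq V]

theorem faceCount_link (K : PreAbstractSimplicialComplex V) {d : ℕ} (hd : 1 ≤ d) (a : V)
    (x : Finset V) :
    faceCount (link K {a}) (d - 1) x = if a ∈ x then 0 else faceCount K d (insert a x) := by
  split_ifs with hax
  · rw [faceCount, Finset.card_eq_zero, Finset.filter_eq_empty_iff]
    intro y hy hxy
    have := (mem_link.1 (mem_kFaces.1 hy).1).2.1
    rw [Finset.disjoint_singleton_right] at this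
    exact this (hxy hax)
  · refine Finset.card_nbij' (insert a) (fun y => y.erase a) ?_ ?_ ?_ ?_
    · intro y hy
      simp only [Finset.coe_filter, Set.mem_ofPred_eq, mem_kFaces, mem_link,
        Finset.disjoint_singleton_right] at hy ⊢
      obtain ⟨⟨⟨_, hay, hyK⟩, hc⟩, hxy⟩ := hy
      refine ⟨⟨?_, ?_⟩, Finset.insert_subset_insert a hxy⟩
      · rwa [Finset.insert_eq, Finset.union_comm]
      · rw [Finset.card_insert_of_notMem hay, hc]
        omega
    · intro y hy
      simp only [Finset.coe_filter, Set.mem_ofPred_eq, mem_kFaces, mem_link,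
        Finset.disjoint_singleton_right] at hy ⊢
      obtain ⟨⟨hyK, hc⟩, hxy⟩ := hy
      have hay : a ∈ y := hxy (Finset.mem_insert_self a x)
      have hc' : (y.erase a).card = d - 1 + 1 := by
        rw [Finset.card_erase_of_mem hay, hc]
        omega
      refine ⟨⟨⟨?_, Finset.notMem_erase a y, ?_⟩, hc'⟩, ?_⟩
      · rw [← Finset.card_pos, hc']
        omega
      · rwa [Finset.union_comm, ← Finset.insert_eq, Finset.insert_erase hay]
      · exact Finset.subset_erase.2 ⟨(Finset.subset_insert a x).trans hxy, hax⟩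
    · intro y hy
      simp only [Finset.coe_filter, Set.mem_ofPred_eq, mem_kFaces, mem_link,
        Finset.disjoint_singleton_right] at hy
      exact Finset.erase_insert hy.1.1.2.1
    · intro y hy
      simp only [Finset.coe_filter, Set.mem_ofPred_eq] at hy
      exact Finset.insert_erase (hy.2 (Finset.mem_insert_self a x))

theorem triangleWeight_edge_eq_faceCount_link (K : PreAbstractSimplicialComplex V) {d : ℕ}
    (hd : 1 ≤ d) (a b : V) :
    (triangleWeight K d).edge a b = ((d : ℝ) - 1) * faceCount (link K {a}) (d - 1) {b} := by
  rw [triangleWeight_edge, faceCount_link K hd]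
  by_cases hab : a = b <;> simp [hab]

theorem triangleWeight_w_eq_faceCount_link (K : PreAbstractSimplicialComplex V) {d : ℕ}
    (hd : 1 ≤ d) (a b c : V) :
    (triangleWeight K d).w a b c =
      if b = c then 0 else (faceCount (link K {a}) (d - 1) {b, c} : ℝ) := by
  rw [triangleWeight_w, faceCount_link K hd]
  by_cases hab : a = b <;> by_cases hac : a = c <;> by_cases hbc : b = c <;> simp [hab, hac, hbc]

theorem sum_kFaces_zero {R : Type*} [AddCommMonoid R] (K : PreAbstractSimplicialComplex V)
    (g : Finset V → R) (hg : ∀ u, ({u} : Finset V) ∉ kFaces K 0 → g {u} = 0) :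
    ∑ x : kFaces K 0, g x.1 = ∑ u, g {u} := by
  rw [Finset.sum_coe_sort (kFaces K 0) g]
  symm
  rw [← Finset.sum_subset (Finset.subset_univ
    (Finset.univ.filter fun u => ({u} : Finset V) ∈ kFaces K 0)) fun u _ hu =>
      hg u fun h => hu (Finset.mem_filter.2 ⟨Finset.mem_univ u, h⟩)]
  refine Finset.sum_bij (fun u _ => {u}) (fun u hu => (Finset.mem_filter.1 hu).2)
    (fun u _ v _ h => Finset.singleton_injective h) (fun x hx => ?_) (fun _ _ => rfl)
  obtain ⟨u, rfl⟩ := Finset.card_eq_one.1 (mem_kFaces.1 hx).2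
  exact ⟨u, Finset.mem_filter.2 ⟨Finset.mem_univ u, hx⟩, rfl⟩

/-- Spectral expansion of the links, as defined through eigenvectors of the weighted adjacency
operators, gives the bound on quadratic forms. -/
theorem IsPure.linkGap {K : PreAbstractSimplicialComplex V} {d : ℕ} (hd : 2 ≤ d)
    (hK : IsPure K d) {lam lo : ℝ} (h0 : 0 ≤ lam)
    (hexp : ∀ a : V, IsSpectralExpander (link K {a}) (d - 1) (Set.Icc lo lam)) :
    (triangleWeight K d).LinkGap lam := by
  intro a
  have hd1 : 1 ≤ d := by omega
  have hdR : (2 : ℝ) ≤ d := by exact_mod_cast hd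
  have hdR1 : (d : ℝ) - 1 ≠ 0 := by linarith
  have hdR0 : (d : ℝ) ≠ 0 := by linarith
  set T := triangleWeight K d with hT
  set n : Finset V → ℝ := fun x => faceCount (link K {a}) (d - 1) x with hn
  set N : ℝ := ((kFaces (link K {a}) (d - 1)).card : ℝ) with hN
  have hedge : ∀ b, T.edge a b = ((d : ℝ) - 1) * n {b} :=
    triangleWeight_edge_eq_faceCount_link K hd1 a
  have hw : ∀ b c, T.w a b c = if b = c then 0 else n {b, c} :=
    triangleWeight_w_eq_faceCount_link K hd1 a
  have hn0 : ∀ u, ({u} : Finset V) ∉ kFaces (link K {a}) 0 → n {u} = 0 := by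
    intro u hu
    by_contra h
    exact hu (mem_kFaces.2 ⟨mem_of_faceCount_ne_zero (Finset.singleton_nonempty u)
      
      (Nat.cast_ne_zero.1 h), Finset.card_singleton u⟩)
  have hnpos : ∀ u, ({u} : Finset V) ∈ kFaces (link K {a}) 0 → 0 < n {u} := by
    intro u hu
    have h := (mem_kFaces.1 hu).1
    have hau : a ∉ ({u} : Finset V) := Finset.disjoint_singleton_right.1 (mem_link.1 h).2.1
    have h' := (mem_link.1 h).2.2
    rw [Finset.union_comm, ← Finset.insert_eq] at h'
    simp only [hn, faceCount_link K hd1, hau, if_false]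
    exact_mod_cast hK.faceCount_pos h'
  have hw0 : ∀ b c, ({c} : Finset V) ∉ kFaces (link K {a}) 0 → T.w a b c = 0 := by
    intro b c hc
    have h1 : T.edge a c = 0 := by rw [hedge, hn0 c hc, mul_zero]
    rw [T.swap_right]
    exact (Finset.sum_eq_zero_iff_of_nonneg fun y _ => T.nonneg a c y).1 h1 b (Finset.mem_univ b)
  have hweight1 : ∀ u, weight (link K {a}) (d - 1) {u} = n {u} / (d * N) := by
    intro u
    rw [weight_eq_faceCount_div, Finset.card_singleton, Nat.sub_add_cancel hd1, Nat.choose_one_right]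
  refine quadForm_le_of_eigenvalue_le (T.w a) (T.swap_right a) (T.nonneg a) h0 ?_
  intro μ f hmean ⟨x, hx, hfx⟩ heig
  change ∑ b, T.edge a b * f b = 0 at hmean
  change ∀ b, ∑ c, T.w a b c * f c = μ * T.edge a b * f b at heig
  change T.edge a x ≠ 0 at hx
  -- The function on the `0`-faces of the link that corresponds to `f`.
  set f' : kFaces (link K {a}) 0 → ℝ := fun y => ∑ u ∈ y.1, f u with hf'
  refine (hexp a μ f' ?_ ⟨Module.End.mem_eigenspace_iff.2 ?_, ?_⟩).2
  · rw [sum_kFaces_zero (link K {a}) (fun y => weight (link K {a}) (d - 1) y * ∑ u ∈ y, f u)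
      fun u hu => by rw [hweight1, hn0 u hu, zero_div, zero_mul]]
    have e : ∀ u, weight (link K {a}) (d - 1) {u} * ∑ v ∈ ({u} : Finset V), f v =
        T.edge a u * f u * (((d : ℝ) - 1) * (d * N))⁻¹ := by
      intro u
      rw [hweight1, hedge, Finset.sum_singleton, mul_inv]
      field_simp
    simp only [e, ← Finset.sum_mul, hmean, zero_mul]
  · ext ⟨y, hy⟩
    obtain ⟨b, rfl⟩ := Finset.card_eq_one.1 (mem_kFaces.1 hy).2
    have hb := hnpos b hy
    have hN0 : 0 < N := 
      lt_of_lt_of_le hb (Nat.cast_le.2 (faceCount_le_card_kFaces _ _ _))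
    have hentry : ∀ c, ({c} : Finset V) ∈ kFaces (link K {a}) 0 →
        (if {b} ∪ {c} ∈ kFaces (link K {a}) 1 then weight (link K {a}) (d - 1) ({b} ∪ {c}) /
          (2 * weight (link K {a}) (d - 1) {b}) else 0) = T.w a b c / T.edge a b := by
      intro c _
      rw [hw, hedge, ← Finset.insert_eq]
      by_cases hbc : b = c
      · simp [hbc, mem_kFaces]
      rw [if_neg hbc]
      split_ifs with h
      · rw [hweight1, weight_eq_faceCount_div, Finset.card_pair hbc, Nat.sub_add_cancel hd1,
          Nat.cast_choose_two]
        change n {b, c} / (_ * N) / _ = _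
        field_simp
      · have : n {b, c} = 0 := by
          by_contra h'
          exact h (mem_kFaces.2 ⟨mem_of_faceCount_ne_zero (Finset.insert_nonempty b {c})
            (Nat.cast_ne_zero.1 h'), Finset.card_pair hbc⟩)
        rw [this, zero_div]
    have hsum : (adjacencyOperator (link K {a}) (d - 1) f') ⟨{b}, hy⟩ =
        ∑ c, T.w a b c / T.edge a b * f c := by
      have e1 := sum_kFaces_zero (link K {a}) (fun y =>
        (if y ∈ kFaces (link K {a}) 0 then (if {b} ∪ y ∈ kFaces (link K {a}) 1 then
          weight (link K {a}) (d - 1) ({b} ∪ y) / (2 * weight (link K {a}) (d - 1) {b}) else 0)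
          else 0) * ∑ u ∈ y, f u) fun u hu => by simp [hu]
      simp only [adjacencyOperator, Matrix.toLin'_apply, Matrix.mulVec, dotProduct,
        Matrix.of_apply, hf']
      calc _ = _ := Finset.sum_congr rfl fun y _ => by rw [if_pos y.2]
        _ = _ := e1
        _ = _ := Finset.sum_congr rfl fun c _ => by
          by_cases hc : ({c} : Finset V) ∈ kFaces (link K {a}) 0
          · rw [if_pos hc, hentry c hc, Finset.sum_singleton]
          · rw [if_neg hc, hw0 b c hc, zero_div, zero_mul, zero_mul]
    rw [hsum]
    have hne : T.edge a b ≠ 0 := by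
      rw [hedge]
      exact mul_ne_zero hdR1 hb.ne'
    calc ∑ c, T.w a b c / T.edge a b * f c = (∑ c, T.w a b c * f c) / T.edge a b := by
          rw [Finset.sum_div]
          exact Finset.sum_congr rfl fun c _ => by ring
      _ = μ * f b := by
          rw [heig]
          field_simp
      _ = _ := by simp [hf']
  · have hxL : ({x} : Finset V) ∈ kFaces (link K {a}) 0 := by
      by_contra h
      exact hx (by rw [hedge, hn0 x h, mul_zero])
    intro h
    have := congrFun h ⟨{x}, hxL⟩
    simp only [hf', Finset.sum_singleton] at this
    exact hfx this

end Link

section Connected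

theorem eq_of_connected {V : Type u} [DecidableEq V] {X : AbstractSimplicialComplex V}
    (hX : (underlyingGraph X).Connected) {R : Type*} (P : V → R)
    (h : ∀ a b, a ≠ b → ({a, b} : Finset V) ∈ X → P a = P b) (a b : V) : P a = P b := by
  obtain ⟨p⟩ := hX.preconnected a b
  induction p with
  | nil => rfl
  | cons hadj _ ih => exact (h _ _ hadj.1 hadj.2).trans ih

variable {V : Type u} [Fintype V] [DecidableEq V] {X : AbstractSimplicialComplex V}

theorem IsPure.triangleWeight_edge_pos {K : PreAbstractSimplicialComplex V} {d : ℕ} (hd : 2 ≤ d)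
    (hK : IsPure K d) {a b : V} (hab : a ≠ b) (h : {a, b} ∈ K) :
    0 < (triangleWeight K d).edge a b := by
  have hdR : (2 : ℝ) ≤ d := by exact_mod_cast hd
  rw [triangleWeight_edge, if_neg hab]
  have : (0 : ℝ) < faceCount K d {a, b} := by exact_mod_cast hK.faceCount_pos h
  exact mul_pos (by linarith) this

theorem IsPure.graphGap {d : ℕ} (hd : 2 ≤ d) (hK : IsPure X.toPreAbstractSimplicialComplex d)
    (hX : (underlyingGraph X).Connected) {lam : ℝ} (h0 : 0 ≤ lam) (h1 : lam < 1)
    (hT : (triangleWeight X.toPreAbstractSimplicialComplex d).LinkGap lam) :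
    (triangleWeight X.toPreAbstractSimplicialComplex d).GraphGap (lam / (1 - lam)) :=
  hT.graphGap h0 h1 fun f hf => eq_of_connected hX f fun _ _ hab h =>
    hf _ _ (hK.triangleWeight_edge_pos hd hab h).ne'

end Connected

end SheafCode

/-! ### Cocycles in the star of a vertex -/

namespace SheafCode

section Signs

variable {V : Type u} [LinearOrder V]

/-- The sign `[{a, b} : {a}]`. -/
def orderSign (a b : V) : ℤ := if a < b then -1 else 1

theorem orderSign_mul_self (a b : V) : orderSign a b * orderSign a b = 1 := by
  unfold orderSign; split_ifs <;> norm_num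

theorem orderSign_swap {a b : V} (h : a ≠ b) : orderSign b a = -orderSign a b := by
  unfold orderSign
  rcases lt_or_gt_of_ne h with h | h <;> simp [h, h.not_gt]

theorem incidenceSign_edge {a b : V} (h : a ≠ b) : incidenceSign {a, b} {a} = orderSign a b := by
  have e : ({a, b} : Finset V) \ {a} = {b} := by
    ext x; simp only [Finset.mem_sdiff, Finset.mem_insert, Finset.mem_singleton]; grind
  simp only [incidenceSign, e, Finset.mem_singleton, exists_eq_left, orderSign,
    Finset.filter_insert, Finset.filter_singleton, lt_irrefl, if_false]
  split_ifs <;> simp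

theorem incidenceSign_triangle {a b c : V} (hab : a ≠ b) (hac : a ≠ c) (hbc : b ≠ c) :
    incidenceSign {a, b, c} {a, b} = orderSign a c * orderSign b c := by
  have e : ({a, b, c} : Finset V) \ {a, b} = {c} := by
    ext x; simp only [Finset.mem_sdiff, Finset.mem_insert, Finset.mem_singleton]; grind
  simp only [incidenceSign, e, Finset.mem_singleton, exists_eq_left, orderSign,
    Finset.filter_insert, Finset.filter_singleton, lt_irrefl, if_false]
  split_ifs <;> simp [hab]

end Signs

theorem eq_pair_of_subset_triple {V : Type u} [DecidableEq V] {x : Finset V} {a b c : V}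
    (hx : x.card = 2) (hsub : x ⊆ {a, b, c}) : x = {a, b} ∨ x = {a, c} ∨ x = {b, c} := by
  obtain ⟨p, q, hpq, rfl⟩ := Finset.card_eq_two.1 hx
  have hp := hsub (Finset.mem_insert_self p _)
  have hq := hsub (Finset.mem_insert_of_mem (Finset.mem_singleton_self q))
  simp only [Finset.mem_insert, Finset.mem_singleton] at hp hq
  rcases hp with rfl | rfl | rfl <;> rcases hq with rfl | rfl | rfl
  exacts [(hpq rfl).elim, .inl rfl, .inr (.inl rfl), .inl (Finset.pair_comm _ _), (hpq rfl).elim,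
    .inr (.inr rfl), .inr (.inl (Finset.pair_comm _ _)), .inr (.inr (Finset.pair_comm _ _)),
    (hpq rfl).elim]

section Sheaf

variable {V : Type u} {K : PreAbstractSimplicialComplex V} {𝔽 : Type v} [Field 𝔽]

theorem Sheaf.coboundary_apply [Fintype V] [LinearOrder V] (F : Sheaf.{u, v, w} K 𝔽) (k : ℕ)
    (f : F.Cochain k) (y : kFaces K (k + 1)) :
    F.coboundary k f y = ∑ x : kFaces K k, open Classical in
      if h : toFace x < toFace y then (incidenceSign y.1 x.1 : 𝔽) • F.res h (f x) else 0 := by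
  simp only [Sheaf.coboundary, LinearMap.pi_apply, LinearMap.sum_apply]
  refine Finset.sum_congr rfl fun x _ => ?_
  split_ifs <;> rfl

theorem Sheaf.IsLocallyConstant.res_injective {F : Sheaf.{u, v, w} K 𝔽} (hF : F.IsLocallyConstant)
    {x y : K} (h : x < y) : Function.Injective (F.res h) := by
  obtain ⟨A, _, _, φ, hφ⟩ := hF x
  intro s t hst
  have e : ∀ s, F.res h s = φ ⟨y, h.le⟩ ((φ ⟨x, le_rfl⟩).symm s) := fun s => by
    rw [← hφ ⟨x, le_rfl⟩ ⟨y, h.le⟩ h, LinearEquiv.apply_symm_apply]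
  rw [e, e] at hst
  exact (φ ⟨x, le_rfl⟩).symm.injective ((φ ⟨y, h.le⟩).injective hst)

/-- If a `1`-cocycle vanishes on the edge `{a, b}` of a triangle `{v, a, b}`, then its values at
`{v, a}` and `{v, b}` agree up to sign, when the sheaf is trivialized around `v`. -/
theorem Sheaf.signed_eq_of_mem_cocycles [Fintype V] [LinearOrder V] (F : Sheaf.{u, v, w} K 𝔽)
    {f : F.Cochain 1} (hf : f ∈ F.cocycles 1) {v a b : V} (hva : v ≠ a) (hvb : v ≠ b) (hab : a ≠ b)
    (hK : {v, a, b} ∈ K) (ha : {v, a} ∈ kFaces K 1) (hb : {v, b} ∈ kFaces K 1)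
    (h0 : ∀ h : {a, b} ∈ kFaces K 1, f ⟨{a, b}, h⟩ = 0) {z : K} {A : Type w} [AddCommGroup A]
    [Module 𝔽 A] (φ : ∀ y : {y : K // z ≤ y}, A ≃ₗ[𝔽] F.obj y.1)
    (hφ : ∀ (y y' : {y : K // z ≤ y}) (h : y.1 < y'.1) (s : A), F.res h (φ y s) = φ y' s)
    (hza : z ≤ toFace ⟨{v, a}, ha⟩) (hzb : z ≤ toFace ⟨{v, b}, hb⟩) :
    (orderSign v a : 𝔽) • (φ ⟨_, hza⟩).symm (f ⟨{v, a}, ha⟩) =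
      (orderSign v b : 𝔽) • (φ ⟨_, hzb⟩).symm (f ⟨{v, b}, hb⟩) := by
  classical
  have hy : ({v, a, b} : Finset V) ∈ kFaces K 2 :=
    mem_kFaces.2 ⟨hK, Finset.card_eq_three.2 ⟨v, a, b, hva, hvb, hab, rfl⟩⟩
  have hlta : toFace (⟨{v, a}, ha⟩ : kFaces K 1) < toFace (⟨{v, a, b}, hy⟩ : kFaces K 2) := by
    change ({v, a} : Finset V) ⊂ {v, a, b}
    rw [Finset.ssubset_iff]
    exact ⟨b, by simp [hvb.symm, hab.symm], by intro x; simp; tauto⟩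
  have hltb : toFace (⟨{v, b}, hb⟩ : kFaces K 1) < toFace (⟨{v, a, b}, hy⟩ : kFaces K 2) := by
    change ({v, b} : Finset V) ⊂ {v, a, b}
    rw [Finset.ssubset_iff]
    exact ⟨a, by simp [hva.symm, hab], by intro x; simp; tauto⟩
  have hne : (⟨{v, a}, ha⟩ : kFaces K 1) ≠ ⟨{v, b}, hb⟩ := by
    intro h
    have h' : a ∈ ({v, b} : Finset V) := by
      have e : ({v, a} : Finset V) = {v, b} := Subtype.ext_iff.1 h
      rw [← e]
      simp
    simp [hva.symm, hab] at h'
  have hcob := congrFun (LinearMap.mem_ker.1 hf) ⟨{v, a, b}, hy⟩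
  rw [Sheaf.coboundary_apply, Fintype.sum_eq_add _ _ hne, dif_pos hlta, dif_pos hltb] at hcob
  · have ra : F.res hlta (f ⟨{v, a}, ha⟩) =
        φ ⟨_, hza.trans hlta.le⟩ ((φ ⟨_, hza⟩).symm (f ⟨{v, a}, ha⟩)) := by
      rw [← hφ ⟨_, hza⟩ ⟨_, hza.trans hlta.le⟩ hlta, LinearEquiv.apply_symm_apply]
    have rb : F.res hltb (f ⟨{v, b}, hb⟩) =
        φ ⟨_, hza.trans hlta.le⟩ ((φ ⟨_, hzb⟩).symm (f ⟨{v, b}, hb⟩)) := by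
      rw [← hφ ⟨_, hzb⟩ ⟨_, hza.trans hlta.le⟩ hltb, LinearEquiv.apply_symm_apply]
    have sa : incidenceSign {v, a, b} {v, a} = orderSign v b * orderSign a b :=
      incidenceSign_triangle hva hvb hab
    have sb : incidenceSign {v, a, b} {v, b} = -(orderSign v a * orderSign a b) := by
      rw [Finset.pair_comm a b, incidenceSign_triangle hvb hva hab.symm, orderSign_swap hab, mul_neg]
    rw [ra, rb, sa, sb] at hcob
    generalize (φ ⟨_, hza⟩).symm (f ⟨{v, a}, ha⟩) = s at hcob ⊢
    generalize (φ ⟨_, hzb⟩).symm (f ⟨{v, b}, hb⟩) = t at hcob ⊢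
    simp only [← map_smul, ← map_add] at hcob
    have hz := (LinearEquiv.map_eq_zero_iff _).1 hcob
    have h1 : ((orderSign v a : ℤ) : 𝔽) * orderSign v a = 1 := by
      exact_mod_cast congrArg (Int.cast : ℤ → 𝔽) (orderSign_mul_self v a)
    have h2 : ((orderSign v b : ℤ) : 𝔽) * orderSign v b = 1 := by
      exact_mod_cast congrArg (Int.cast : ℤ → 𝔽) (orderSign_mul_self v b)
    have h3 : ((orderSign a b : ℤ) : 𝔽) * orderSign a b = 1 := by
      exact_mod_cast congrArg (Int.cast : ℤ → 𝔽) (orderSign_mul_self a b)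
    push_cast at hz
    generalize ((orderSign v a : ℤ) : 𝔽) = p at hz h1 ⊢
    generalize ((orderSign v b : ℤ) : 𝔽) = q at hz h2 ⊢
    generalize ((orderSign a b : ℤ) : 𝔽) = c at hz h3
    have e1 : p * q * c * (q * c) = p := by linear_combination p * h2 * (c * c) + p * h3
    have e2 : p * q * c * (p * c) = q := by linear_combination q * h1 * (c * c) + q * h3
    have hz' := congrArg (fun x => (p * q * c) • x) hz
    simp only [smul_add, smul_smul, smul_neg, neg_smul, e1, e2, smul_zero] at hz'
    exact sub_eq_zero.1 (by rwa [sub_eq_add_neg])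
  · rintro x ⟨hxa, hxb⟩
    split_ifs with hx
    · have hxab : x.1 = {a, b} := by
        have hsub : x.1 ⊆ {v, a, b} := hx.le
        rcases eq_pair_of_subset_triple (mem_kFaces.1 x.2).2 hsub with h | h | h
        exacts [(hxa (Subtype.ext h)).elim, (hxb (Subtype.ext h)).elim, h]
      obtain ⟨x, hx'⟩ := x
      subst hxab
      rw [h0 hx', map_zero, smul_zero]
    · rfl

end Sheaf

end SheafCode

/-! ### The distance of the code -/

namespace SheafCode

section Counting

theorem card_eq_two_of_mem_kFaces {V : Type u} [Fintype V]
    {K : PreAbstractSimplicialComplex V} :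
    ∀ e ∈ kFaces K 1, e.card = 2 := fun _ he => (mem_kFaces.1 he).2

variable {V : Type u} [Fintype V] [DecidableEq V]

theorem card_filter_pair_mem {A : Finset (Finset V)} (hA : ∀ e ∈ A, e.card = 2) (a : V) :
    (Finset.univ.filter fun b => ({a, b} : Finset V) ∈ A).card = (A.filter fun e => a ∈ e).card := by
  have hne : ∀ b, ({a, b} : Finset V) ∈ A → a ≠ b := by
    rintro b hb rfl
    simpa using hA _ hb
  refine Finset.card_bij (fun b _ => {a, b}) ?_ ?_ ?_
  · intro b hb
    exact Finset.mem_filter.2 ⟨(Finset.mem_filter.1 hb).2, Finset.mem_insert_self a _⟩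
  · intro b hb c hc h
    have hb' := hne b (Finset.mem_filter.1 hb).2
    have : b ∈ ({a, c} : Finset V) := by rw [← h]; simp
    simpa [hb'.symm] using this
  · intro e he
    obtain ⟨heA, hae⟩ := Finset.mem_filter.1 he
    obtain ⟨p, q, hpq, rfl⟩ := Finset.card_eq_two.1 (hA e heA)
    simp only [Finset.mem_insert, Finset.mem_singleton] at hae
    rcases hae with rfl | rfl
    · exact ⟨q, Finset.mem_filter.2 ⟨Finset.mem_univ q, heA⟩, rfl⟩
    · rw [Finset.pair_comm] at heA
      exact ⟨p, Finset.mem_filter.2 ⟨Finset.mem_univ p, heA⟩, Finset.pair_comm _ _⟩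

theorem sum_card_filter_mem {A : Finset (Finset V)} (hA : ∀ e ∈ A, e.card = 2) :
    ∑ a, (A.filter fun e => a ∈ e).card = 2 * A.card := by
  simp only [Finset.card_filter]
  rw [Finset.sum_comm]
  simp only [Finset.sum_boole, Finset.filter_univ_mem, Nat.cast_id]
  rw [Finset.sum_congr rfl hA, Finset.sum_const, smul_eq_mul, mul_comm]

theorem faceCount_le_degree (K : PreAbstractSimplicialComplex V) (d : ℕ) {x : Finset V} {a : V}
    (ha : a ∈ x) : faceCount K d x ≤ degree K d :=
  (faceCount_anti K d (Finset.singleton_subset_iff.2 ha)).trans <| by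
    simp only [faceCount, Finset.singleton_subset_iff]
    exact Finset.le_sup (f := fun a : V => ((kFaces K d).filter fun y => a ∈ y).card)
      (Finset.mem_univ a)

/-- The ratios of canonical weights of edges are those of the numbers of top-dimensional faces. -/
theorem faceCount_le_mul_of_weight_le {K : PreAbstractSimplicialComplex V} {d : ℕ} (hd : 1 ≤ d)
    (hK : IsPure K d) {κ : ℝ} {e e' : Finset V} (he : e.card = 2) (he' : e'.card = 2)
    (h : weight K d e ≤ κ * weight K d e') : (faceCount K d e : ℝ) ≤ κ * faceCount K d e' := by
  have h1 : (0 : ℝ) < (kFaces K d).card := by exact_mod_cast Finset.card_pos.2 hK.1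
  have h2 : (0 : ℝ) < (d + 1).choose 2 := by exact_mod_cast Nat.choose_pos (by omega)
  rw [weight_eq_faceCount_div, weight_eq_faceCount_div, he, he', ← mul_div_assoc] at h
  exact (div_le_div_iff_of_pos_right (mul_pos h2 h1)).1 h

/-- If every vertex is in `Q` edges and edges at a vertex differ in weight by the factor `κ` at most,
then each edge has at most the fraction `κ / Q` of the total weight of the edges at a vertex. -/
theorem mul_edge_le_mul_vertex {K : PreAbstractSimplicialComplex V} {d Q : ℕ} (hd : 2 ≤ d)
    (hK : IsPure K d) {κ : ℝ} (hκ : 0 ≤ κ)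
    (hQ : ∀ a : V, ((kFaces K 1).filter fun e => a ∈ e).card = Q)
    (hw : ∀ e ∈ kFaces K 1, ∀ e' ∈ kFaces K 1, (e ∩ e').Nonempty →
      weight K d e ≤ κ * weight K d e') (a b : V) :
    Q * (triangleWeight K d).edge a b ≤ κ * (triangleWeight K d).vertex a := by
  set T := triangleWeight K d with hT
  have hdR : (2 : ℝ) ≤ d := by exact_mod_cast hd
  by_cases hab : T.edge a b = 0
  · rw [hab, mul_zero]
    exact mul_nonneg hκ (T.vertex_nonneg a)
  have hb : ({a, b} : Finset V) ∈ kFaces K 1 := by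
    rw [hT, triangleWeight_edge] at hab
    have hne : a ≠ b := fun h => hab (if_pos h)
    rw [if_neg hne] at hab
    exact mem_kFaces.2 ⟨mem_of_faceCount_ne_zero (Finset.insert_nonempty a {b})
      (Nat.cast_ne_zero.1 (right_ne_zero_of_mul hab)), Finset.card_pair hne⟩
  have hle : ∀ c ∈ Finset.univ.filter fun c => ({a, c} : Finset V) ∈ kFaces K 1,
      T.edge a b ≤ κ * T.edge a c := by
    intro c hc
    have hc' := (Finset.mem_filter.1 hc).2
    have hne : ∀ {c}, ({a, c} : Finset V) ∈ kFaces K 1 → a ≠ c := by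
      rintro c h rfl
      simpa using (mem_kFaces.1 h).2
    rw [hT, triangleWeight_edge, triangleWeight_edge, if_neg (hne hb), if_neg (hne hc')]
    have := faceCount_le_mul_of_weight_le (by omega) hK (card_eq_two_of_mem_kFaces _ hb)
      (card_eq_two_of_mem_kFaces _ hc') (hw _ hb _ hc' ⟨a, by simp⟩)
    nlinarith
  have hsum := Finset.sum_le_sum hle
  rw [Finset.sum_const, card_filter_pair_mem card_eq_two_of_mem_kFaces, hQ, nsmul_eq_mul,
    ← Finset.mul_sum] at hsum
  refine hsum.trans (mul_le_mul_of_nonneg_left ?_ hκ)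
  exact Finset.sum_le_sum_of_subset_of_nonneg (Finset.subset_univ _) fun c _ _ => T.edge_nonneg a c

end Counting

section Distance

variable {V : Type u} [Fintype V] [LinearOrder V] {X : AbstractSimplicialComplex V} {𝔽 : Type v}
  [Field 𝔽]

/-- Around a vertex `v`, a cochain with values in subspaces in general position takes a given nonzero
value on fewer than `m / r` edges, up to sign. -/
theorem GeneralPosition.card_mul_lt {F : Sheaf.{u, v, w} X.toPreAbstractSimplicialComplex 𝔽}
    {r m : ℕ} (hm : 0 < m)
    {U : ∀ e : kFaces X.toPreAbstractSimplicialComplex 1, Submodule 𝔽 (F.obj (toFace e))}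
    (hU : GeneralPosition F r m U) (f : F.Cochain 1) (hfU : ∀ e, f e ∈ U e) (v : V)
    {A : Type w} [AddCommGroup A] [Module 𝔽 A]
    (φ : ∀ y : {y : X.toPreAbstractSimplicialComplex // ⟨{v}, X.singleton_mem v⟩ ≤ y},
      A ≃ₗ[𝔽] F.obj y.1)
    (hφ : ∀ y y' (h : y.1 < y'.1) (s : A), F.res h (φ y s) = φ y' s)
    (g : A) (s : Finset V)
    (hs : ∀ a ∈ s, ∃ (h : {v, a} ∈ kFaces X.toPreAbstractSimplicialComplex 1)
      (h' : ⟨{v}, X.singleton_mem v⟩ ≤ toFace ⟨{v, a}, h⟩),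
      f ⟨{v, a}, h⟩ ≠ 0 ∧ g = (orderSign v a : 𝔽) • (φ ⟨_, h'⟩).symm (f ⟨{v, a}, h⟩)) :
    s.card * r < m := by
  by_contra! hcard
  choose h h' hs' using fun a : s => hs a.1 a.2
  set S : Finset {e : kFaces X.toPreAbstractSimplicialComplex 1 // v ∈ e.1} :=
    Finset.univ.image fun a : s => ⟨⟨{v, a.1}, h a⟩, Finset.mem_insert_self v _⟩ with hS
  have hinj : Function.Injective fun a : s =>
      (⟨⟨{v, a.1}, h a⟩, Finset.mem_insert_self v _⟩ :
        {e : kFaces X.toPreAbstractSimplicialComplex 1 // v ∈ e.1}) := by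
    intro a b hab
    have e : ({v, a.1} : Finset V) = {v, b.1} := by simpa using hab
    have hva : v ≠ a.1 := by
      intro h0
      have := (mem_kFaces.1 (h a)).2
      rw [← h0] at this
      simp at this
    have : a.1 ∈ ({v, b.1} : Finset V) := by rw [← e]; simp
    exact Subtype.ext (by simpa [hva.symm] using this)
  have hScard : S.card = s.card := by
    rw [hS, Finset.card_image_of_injective _ hinj, Finset.card_univ, Fintype.card_coe]
  have hbot := hU v S (by rwa [hScard])
  have hmem : φ ⟨⟨{v}, X.singleton_mem v⟩, le_rfl⟩ g ∈
      ⨅ e ∈ S, (U e.1).comap (F.res (vertex_lt_edge X v e)) := by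
    simp only [Submodule.mem_iInf, Submodule.mem_comap]
    intro e he
    obtain ⟨a, -, rfl⟩ := Finset.mem_image.1 he
    have hres : F.res (vertex_lt_edge X v ⟨⟨{v, a.1}, h a⟩, Finset.mem_insert_self v _⟩)
        (φ ⟨⟨{v}, X.singleton_mem v⟩, le_rfl⟩ g) = φ ⟨_, h' a⟩ g :=
      hφ ⟨_, le_rfl⟩ ⟨_, h' a⟩ _ g
    rw [hres, (hs' a).2, map_smul, LinearEquiv.apply_symm_apply]
    exact Submodule.smul_mem _ _ (hfU _)
  rw [hbot, Submodule.mem_bot, LinearEquiv.map_eq_zero_iff] at hmem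
  have hpos : 0 < s.card := by
    by_contra! h0
    have : s.card = 0 := by omega
    rw [this] at hcard
    omega
  obtain ⟨a, ha⟩ := Finset.card_pos.1 hpos
  obtain ⟨hne, heq⟩ := hs' ⟨a, ha⟩
  rw [hmem] at heq
  have hsign : ((orderSign v a : ℤ) : 𝔽) ≠ 0 := by
    unfold orderSign; split_ifs <;> simp
  exact hne ((LinearEquiv.map_eq_zero_iff _).1 ((smul_eq_zero.1 heq.symm).resolve_left hsign))

/-- A sparse cocycle with values in subspaces in general position vanishes. Here `1 - ρ` bounds the
share of a nonzero label in a link, and `h` separates thin from fat vertices. -/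
theorem eq_zero_of_sparse_of_mem_cocycles {Q r m d : ℕ} {lam κ ρ h : ℝ} (hr : 0 < r)
    (hm : 0 < m) (hQ0 : 0 < Q) (hκ : 0 ≤ κ) (h0 : 0 ≤ lam) (h1 : lam < 1) (hh : 0 < h)
    (hh2 : lam / (1 - lam) ≤ h ^ 2 / 6) (hhρ : 4 * (lam + h) ≤ ρ * (1 - lam))
    (hρ : 1 - ρ = κ / Q / ((r : ℝ) / m)) (hd : 2 ≤ d)
    (hX : IsPure X.toPreAbstractSimplicialComplex d) (hconn : (underlyingGraph X).Connected)
    (hQ : ∀ a : V,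
      ((kFaces X.toPreAbstractSimplicialComplex 1).filter fun e => a ∈ e).card = Q)
    (hT : (triangleWeight X.toPreAbstractSimplicialComplex d).LinkGap lam)
    (hw : ∀ e ∈ kFaces X.toPreAbstractSimplicialComplex 1,
      ∀ e' ∈ kFaces X.toPreAbstractSimplicialComplex 1, (e ∩ e').Nonempty →
        weight X.toPreAbstractSimplicialComplex d e ≤
          κ * weight X.toPreAbstractSimplicialComplex d e')
    {F : Sheaf.{u, v, w} X.toPreAbstractSimplicialComplex 𝔽} (hF : F.IsLocallyConstant)
    {U : ∀ e : kFaces X.toPreAbstractSimplicialComplex 1, Submodule 𝔽 (F.obj (toFace e))}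
    (hU : GeneralPosition F r m U) (f : F.Cochain 1) (hf : f ∈ F.cocycles 1)
    (hfU : ∀ e, f e ∈ U e)
    (hsmall : open Classical in degree X.toPreAbstractSimplicialComplex d *
      ((Finset.univ.filter fun e => f e ≠ 0).card : ℝ) ≤
        h ^ 3 / 6 * (kFaces X.toPreAbstractSimplicialComplex 1).card) : f = 0 := by
  classical
  set T := triangleWeight X.1 d with hTdef
  have hdR : (2 : ℝ) ≤ d := by exact_mod_cast hd
  have hnev : ∀ {a b : V}, ({a, b} : Finset V) ∈ kFaces X.1 1 → a ≠ b := by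
    rintro a b h rfl
    simpa using (mem_kFaces.1 h).2
  -- The set of edges that support `f`.
  set A : Finset (Finset V) := (Finset.univ.filter fun e => f e ≠ 0).image Subtype.val with hA
  set s : V → V → Prop := fun a b => {a, b} ∈ A with hsdef
  have hs : ∀ a b, s a b ↔ s b a := by
    intro a b
    simp only [hsdef, Finset.pair_comm a b]
  have hsA : ∀ a b, s a b ↔ ∃ h : {a, b} ∈ kFaces X.1 1, f ⟨{a, b}, h⟩ ≠ 0 := by
    intro a b
    simp [hA, hsdef]
  have hA2 : ∀ e ∈ A, e.card = 2 := by
    intro e he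
    obtain ⟨x, -, rfl⟩ := Finset.mem_image.1 he
    exact card_eq_two_of_mem_kFaces _ x.2
  have hAcard : A.card = (Finset.univ.filter fun e => f e ≠ 0).card :=
    Finset.card_image_of_injective _ Subtype.val_injective
  have hpair : ∀ B : Finset (Finset V), (∀ e ∈ B, e.card = 2) →
      ∑ a : V, ∑ b : V, (if ({a, b} : Finset V) ∈ B then (1 : ℝ) else 0) = 2 * B.card := by
    intro B hB
    have := sum_card_filter_mem hB
    simp only [Finset.sum_boole, card_filter_pair_mem hB]
    exact_mod_cast this
  have hedge : ∀ {a b : V}, ({a, b} : Finset V) ∈ kFaces X.1 1 →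
      T.edge a b = ((d : ℝ) - 1) * faceCount X.1 d {a, b} := by
    intro a b hab
    rw [hTdef, triangleWeight_edge, if_neg (hnev hab)]
  have hsparse : (∑ v, ∑ a, T.edge v a * if s v a then 1 else 0) ≤
      h ^ 3 / 6 * ∑ v, T.vertex v := by
    have i1 : (∑ v, ∑ a, T.edge v a * if s v a then 1 else 0) ≤
        ((d : ℝ) - 1) * degree X.1 d * (2 * A.card) := by
      rw [← hpair A hA2, Finset.mul_sum]
      refine Finset.sum_le_sum fun a _ => ?_
      rw [Finset.mul_sum]
      refine Finset.sum_le_sum fun b _ => ?_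
      simp only [hsdef]
      split_ifs with hab
      · obtain ⟨hab', -⟩ := (hsA a b).1 hab
        rw [hedge hab', mul_one, mul_one]
        refine mul_le_mul_of_nonneg_left ?_ (by linarith)
        exact_mod_cast faceCount_le_degree X.1 d (Finset.mem_insert_self a {b})
      · simp
    have i2 : ((d : ℝ) - 1) * (2 * (kFaces X.1 1).card) ≤ ∑ v, T.vertex v := by
      rw [← hpair _ card_eq_two_of_mem_kFaces, Finset.mul_sum]
      refine Finset.sum_le_sum fun a _ => ?_
      rw [Finset.mul_sum]
      refine Finset.sum_le_sum fun b _ => ?_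
      split_ifs with hab
      · rw [hedge hab]
        refine mul_le_mul_of_nonneg_left ?_ (by linarith)
        exact_mod_cast hX.faceCount_pos (mem_kFaces.1 hab).1
      · simpa using T.edge_nonneg a b
    rw [← hAcard] at hsmall
    calc _ ≤ _ := i1
      _ = ((d : ℝ) - 1) * 2 * (degree X.1 d * A.card) := by ring
      _ ≤ ((d : ℝ) - 1) * 2 * (h ^ 3 / 6 * (kFaces X.1 1).card) :=
          mul_le_mul_of_nonneg_left hsmall (by linarith)
      _ = h ^ 3 / 6 * (((d : ℝ) - 1) * (2 * (kFaces X.1 1).card)) := by ring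
      _ ≤ _ := mul_le_mul_of_nonneg_left i2 (by positivity)
  -- Trivializations around the vertices.
  choose A' iA mA φ hφ using fun v : V => hF ⟨{v}, X.singleton_mem v⟩
  have hle : ∀ {v a : V} (h : {v, a} ∈ kFaces X.1 1),
      (⟨{v}, X.singleton_mem v⟩ : X.1) ≤ toFace ⟨{v, a}, h⟩ := fun {v a} _ => by
    change ({v} : Finset V) ⊆ {v, a}
    simp
  set l : ∀ v, V → A' v := fun v a =>
    if h : {v, a} ∈ kFaces X.1 1 then
      (orderSign v a : 𝔽) • (φ v ⟨_, hle h⟩).symm (f ⟨{v, a}, h⟩) else 0 with hl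
  have htri : ∀ {v a b}, T.w v a b ≠ 0 → v ≠ a ∧ v ≠ b ∧ a ≠ b ∧ ({v, a, b} : Finset V) ∈ X.1 ∧
      ({v, a} : Finset V) ∈ kFaces X.1 1 ∧ ({v, b} : Finset V) ∈ kFaces X.1 1 ∧
        ({a, b} : Finset V) ∈ kFaces X.1 1 := by
    intro v a b hvab
    rw [hTdef, triangleWeight_w] at hvab
    have hne : v ≠ a ∧ v ≠ b ∧ a ≠ b := by
      by_contra hcon
      exact hvab (if_neg hcon)
    rw [if_pos hne] at hvab
    have hmem : ({v, a, b} : Finset V) ∈ X.1 :=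
      mem_of_faceCount_ne_zero (Finset.insert_nonempty _ _) (Nat.cast_ne_zero.1 hvab)
    have hsub : ∀ {p q : V}, p ≠ q → ({p, q} : Finset V) ⊆ {v, a, b} → {p, q} ∈ kFaces X.1 1 :=
      fun hpq hsub => mem_kFaces.2
        ⟨(X.1.isRelLowerSet_faces hmem).2 hsub (Finset.insert_nonempty _ _), Finset.card_pair hpq⟩
    exact ⟨hne.1, hne.2.1, hne.2.2, hmem, hsub hne.1 (by intro x; simp; tauto),
      hsub hne.2.1 (by intro x; simp; tauto), hsub hne.2.2 (by intro x; simp; tauto)⟩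
  have hlab : ∀ v a b, T.w v a b ≠ 0 → ¬ s a b → l v a = l v b := by
    intro v a b hvab hab
    obtain ⟨hva, hvb, hne, hK3, ha, hb, hab'⟩ := htri hvab
    simp only [hl, dif_pos ha, dif_pos hb]
    exact F.signed_eq_of_mem_cocycles hf hva hvb hne hK3 ha hb
      (fun h' => by by_contra h''; exact hab ((hsA a b).2 ⟨h', h''⟩)) (φ v) (hφ v) _ _
  have hsign : ∀ v a : V, ((orderSign v a : ℤ) : 𝔽) ≠ 0 := by
    intro v a
    unfold orderSign
    split_ifs <;> simp
  have hsl : ∀ v a, s v a ↔ l v a ≠ 0 := by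
    intro v a
    rw [hsA]
    by_cases ha : {v, a} ∈ kFaces X.1 1
    · simp [hl, ha, hsign]
    · simp [hl, ha]
  have hzero := hT.sum_edge_support_eq_zero h0 h1 ?_ hh hh2 hhρ (hX.graphGap hd hconn h0 h1 hT)
    s hs ?_ l (fun v a b hvab _ _ hab => hlab v a b hvab hab) ?_ hsparse
  · funext e
    obtain ⟨e, he⟩ := e
    obtain ⟨a, b, hab, rfl⟩ := Finset.card_eq_two.1 (card_eq_two_of_mem_kFaces _ he)
    by_contra hne
    have hnn : ∀ v a, 0 ≤ T.edge v a * if s v a then 1 else 0 := fun v a =>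
      mul_nonneg (T.edge_nonneg v a) (by split_ifs <;> norm_num)
    have z1 := (Finset.sum_eq_zero_iff_of_nonneg fun v _ =>
      Finset.sum_nonneg fun a _ => hnn v a).1 hzero a (Finset.mem_univ a)
    have z2 := (Finset.sum_eq_zero_iff_of_nonneg fun b _ => hnn a b).1 z1 b (Finset.mem_univ b)
    rw [if_pos ((hsA a b).2 ⟨he, hne⟩), mul_one] at z2
    exact (hX.triangleWeight_edge_pos hd hab (mem_kFaces.1 he).1).ne' z2
  · have : 0 ≤ κ / Q / ((r : ℝ) / m) := by positivity
    linarith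
  · intro a b c habc hab hac
    by_contra hbc
    rw [hsl] at hab hac
    rw [hlab a b c habc hbc] at hab
    exact hac hab
  · intro v g
    set B : Finset V := Finset.univ.filter fun a => s v a ∧ l v a = g with hB
    have hcard : B.card * r < m := by
      refine hU.card_mul_lt hm f hfU v (φ v) (hφ v) g B fun a ha => ?_
      obtain ⟨hsva, hg⟩ := (Finset.mem_filter.1 ha).2
      obtain ⟨hva, hne⟩ := (hsA v a).1 hsva
      refine ⟨hva, hle hva, hne, ?_⟩
      simp only [hl, dif_pos hva] at hg
      exact hg.symm
    have hcardR : (B.card : ℝ) * r ≤ m := by exact_mod_cast hcard.le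
    have hQR : (0 : ℝ) < Q := by exact_mod_cast hQ0
    have hrR : (0 : ℝ) < r := by exact_mod_cast hr
    have hmR : (0 : ℝ) < m := by exact_mod_cast hm
    have hp := T.vertex_nonneg v
    have hedge' : ∀ a ∈ B, T.edge v a ≤ κ / Q * T.vertex v := by
      intro a _
      rw [div_mul_eq_mul_div, le_div_iff₀ hQR, mul_comm]
      exact mul_edge_le_mul_vertex hd hX hκ hQ hw v a
    calc (∑ a, T.edge v a * if s v a ∧ l v a = g then 1 else 0) = ∑ a ∈ B, T.edge v a := by
          simp only [hB, Finset.sum_filter, mul_ite, mul_one, mul_zero]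
      _ ≤ ∑ _a ∈ B, κ / Q * T.vertex v := Finset.sum_le_sum hedge'
      _ = B.card * (κ / Q * T.vertex v) := by rw [Finset.sum_const, nsmul_eq_mul]
      _ ≤ m / r * (κ / Q * T.vertex v) :=
          mul_le_mul_of_nonneg_right ((le_div_iff₀ hrR).2 hcardR) (by positivity)
      _ = _ := by
          rw [hρ]
          field_simp

end Distance

end SheafCode

/-! ### The dimension of the code -/

namespace SheafCode

section Coboundary

theorem edgeSubsheaf_carrier_edge {V : Type u} [Fintype V] {K : PreAbstractSimplicialComplex V}
    {𝔽 : Type v} [Field 𝔽] (F : Sheaf.{u, v, w} K 𝔽)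
    (U : ∀ e : kFaces K 1, Submodule 𝔽 (F.obj (toFace e))) (e : kFaces K 1) :
    (edgeSubsheaf F U).carrier (toFace e) = U e :=
  dif_pos (mem_kFaces.1 e.2).2

variable {V : Type u} [Fintype V] [LinearOrder V] {K : PreAbstractSimplicialComplex V}
  {𝔽 : Type v} [Field 𝔽]

theorem singleton_lt_pair {a b : V} (hab : a ≠ b) (ha : {a} ∈ kFaces K 0)
    (he : {a, b} ∈ kFaces K 1) :
    toFace (⟨{a}, ha⟩ : kFaces K 0) < toFace (⟨{a, b}, he⟩ : kFaces K 1) := by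
  change ({a} : Finset V) ⊂ {a, b}
  rw [Finset.ssubset_iff]
  exact ⟨b, by simpa using hab.symm, by intro x; simp; tauto⟩

theorem singleton_lt_pair' {a b : V} (hab : a ≠ b) (hb : {b} ∈ kFaces K 0)
    (he : {a, b} ∈ kFaces K 1) :
    toFace (⟨{b}, hb⟩ : kFaces K 0) < toFace (⟨{a, b}, he⟩ : kFaces K 1) := by
  change ({b} : Finset V) ⊂ {a, b}
  rw [Finset.ssubset_iff]
  exact ⟨a, by simpa using hab, by intro x; simp⟩

theorem Sheaf.coboundary_zero_apply (F : Sheaf.{u, v, w} K 𝔽) (f : F.Cochain 0) {a b : V}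
    (hab : a ≠ b) (ha : {a} ∈ kFaces K 0) (hb : {b} ∈ kFaces K 0) (he : {a, b} ∈ kFaces K 1) :
    F.coboundary 0 f ⟨{a, b}, he⟩ =
      (orderSign a b : 𝔽) • F.res (singleton_lt_pair hab ha he) (f ⟨{a}, ha⟩) +
        (orderSign b a : 𝔽) • F.res (singleton_lt_pair' hab hb he) (f ⟨{b}, hb⟩) := by
  have hne : (⟨{a}, ha⟩ : kFaces K 0) ≠ ⟨{b}, hb⟩ := by
    intro h
    exact hab (Finset.singleton_injective (Subtype.ext_iff.1 h))
  have sb : incidenceSign {a, b} {b} = orderSign b a := by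
    rw [Finset.pair_comm, incidenceSign_edge hab.symm]
  rw [F.coboundary_apply 0, Fintype.sum_eq_add _ _ hne, dif_pos (singleton_lt_pair hab ha he),
    dif_pos (singleton_lt_pair' hab hb he), sb, incidenceSign_edge hab]
  rintro ⟨x, hx⟩ ⟨hxa, hxb⟩
  refine dif_neg fun h => ?_
  obtain ⟨c, rfl⟩ := Finset.card_eq_one.1 (mem_kFaces.1 hx).2
  have hsub : ({c} : Finset V) ⊆ {a, b} := h.le
  simp only [Finset.singleton_subset_iff, Finset.mem_insert, Finset.mem_singleton] at hsub
  rcases hsub with rfl | rfl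
  exacts [hxa rfl, hxb rfl]

theorem Sheaf.coboundary_coboundary_zero (F : Sheaf.{u, v, w} K 𝔽) (f : F.Cochain 0) :
    F.coboundary 1 (F.coboundary 0 f) = 0 := by
  classical
  funext ⟨y, hy⟩
  obtain ⟨a, b, c, hab, hac, hbc, rfl⟩ := Finset.card_eq_three.1 (mem_kFaces.1 hy).2
  have hyK := (mem_kFaces.1 hy).1
  have hface : ∀ x : Finset V, x.Nonempty → x ⊆ {a, b, c} → x ∈ K := fun x h1 h2 =>
    (K.isRelLowerSet_faces hyK).2 h2 h1
  have va : {a} ∈ kFaces K 0 := mem_kFaces.2 ⟨hface _ (by simp) (by simp), rfl⟩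
  have vb : {b} ∈ kFaces K 0 := mem_kFaces.2 ⟨hface _ (by simp) (by simp), rfl⟩
  have vc : {c} ∈ kFaces K 0 := mem_kFaces.2 ⟨hface _ (by simp) (by simp), rfl⟩
  have sab : ({a, b} : Finset V) ⊆ {a, b, c} := by intro x; simp; tauto
  have sac : ({a, c} : Finset V) ⊆ {a, b, c} := by intro x; simp; tauto
  have sbc : ({b, c} : Finset V) ⊆ {a, b, c} := by intro x; simp; tauto
  have eab : {a, b} ∈ kFaces K 1 := mem_kFaces.2 ⟨hface _ (by simp) sab, Finset.card_pair hab⟩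
  have eac : {a, c} ∈ kFaces K 1 := mem_kFaces.2 ⟨hface _ (by simp) sac, Finset.card_pair hac⟩
  have ebc : {b, c} ∈ kFaces K 1 := mem_kFaces.2 ⟨hface _ (by simp) sbc, Finset.card_pair hbc⟩
  have lt : ∀ {x : Finset V} (hx : x ∈ kFaces K 1), x ⊆ {a, b, c} →
      toFace (⟨x, hx⟩ : kFaces K 1) < toFace (⟨{a, b, c}, hy⟩ : kFaces K 2) := by
    intro x hx hsub
    change x ⊂ {a, b, c}
    refine lt_of_le_of_ne hsub fun h => ?_
    have h1 := (mem_kFaces.1 hx).2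
    rw [h, (mem_kFaces.1 hy).2] at h1
    omega
  have n1 : ({a, b} : Finset V) ≠ {a, c} := fun h => by
    have : b ∈ ({a, c} : Finset V) := by rw [← h]; simp
    simp [hab.symm, hbc] at this
  have n2 : ({a, b} : Finset V) ≠ {b, c} := fun h => by
    have : a ∈ ({b, c} : Finset V) := by rw [← h]; simp
    simp [hab, hac] at this
  have n3 : ({a, c} : Finset V) ≠ {b, c} := fun h => by
    have : a ∈ ({b, c} : Finset V) := by rw [← h]; simp
    simp [hab, hac] at this
  have s1 : incidenceSign {a, b, c} {a, b} = orderSign a c * orderSign b c :=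
    incidenceSign_triangle hab hac hbc
  have s2 : incidenceSign {a, b, c} {a, c} = -(orderSign a b * orderSign b c) := by
    rw [Finset.pair_comm b c, incidenceSign_triangle hac hab hbc.symm, orderSign_swap hbc, mul_neg]
  have s3 : incidenceSign {a, b, c} {b, c} = orderSign a b * orderSign a c := by
    have : ({a, b, c} : Finset V) = {b, c, a} := by ext; simp; tauto
    rw [this, incidenceSign_triangle hbc hab.symm hac.symm, orderSign_swap hab, orderSign_swap hac,
      neg_mul_neg]
  rw [F.coboundary_apply 1, ← Finset.sum_subset
    (Finset.subset_univ ({⟨{a, b}, eab⟩, ⟨{a, c}, eac⟩, ⟨{b, c}, ebc⟩} : Finset (kFaces K 1)))]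
  · rw [Finset.sum_insert (by simp [n1, n2]), Finset.sum_insert (by simp [n3]),
      Finset.sum_singleton, dif_pos (lt eab sab), dif_pos (lt eac sac), dif_pos (lt ebc sbc),
      F.coboundary_zero_apply f hab va vb eab, F.coboundary_zero_apply f hac va vc eac,
      F.coboundary_zero_apply f hbc vb vc ebc, s1, s2, s3]
    simp only [map_add, map_smul, F.res_res, orderSign_swap hab, orderSign_swap hac,
      orderSign_swap hbc]
    push_cast
    simp only [Pi.zero_apply]
    module
  · rintro ⟨x, hx⟩ - hxn
    refine dif_neg fun h => hxn ?_
    rcases eq_pair_of_subset_triple (mem_kFaces.1 hx).2 h.le with rfl | rfl | rfl <;> simp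

theorem Subsheaf.mem_cocycles_iff {F : Sheaf.{u, v, w} K 𝔽} (G : Subsheaf F) (k : ℕ)
    (f : G.toSheaf.Cochain k) :
    f ∈ G.toSheaf.cocycles k ↔ (fun x => (f x).1 : F.Cochain k) ∈ F.cocycles k := by
  have h : ∀ y, (G.toSheaf.coboundary k f y).1 = F.coboundary k (fun x => (f x).1) y := by
    intro y
    rw [Sheaf.coboundary_apply, Sheaf.coboundary_apply]
    refine (map_sum (G.carrier (toFace y)).subtype _ _).trans (Finset.sum_congr rfl fun x _ => ?_)
    split_ifs <;> rfl
  rw [Sheaf.cocycles, Sheaf.cocycles, LinearMap.mem_ker, LinearMap.mem_ker]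
  constructor
  · intro hf
    funext y
    rw [← h, hf]
    rfl
  · intro hf
    funext y
    apply Subtype.ext
    rw [h, hf]
    rfl

end Coboundary

section Dimension

theorem singleton_mem_kFaces {V : Type u} [Fintype V] (X : AbstractSimplicialComplex V) (a : V) :
    {a} ∈ kFaces X.toPreAbstractSimplicialComplex 0 :=
  mem_kFaces.2 ⟨X.singleton_mem a, rfl⟩

variable {V : Type u} [Fintype V] [LinearOrder V] {X : AbstractSimplicialComplex V} {𝔽 : Type v}
  [Field 𝔽]

theorem card_kFaces_zero (X : AbstractSimplicialComplex V) :
    (kFaces X.toPreAbstractSimplicialComplex 0).card = Fintype.card V := by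
  have := sum_kFaces_zero X.toPreAbstractSimplicialComplex (fun _ => 1) fun u hu =>
    (hu (singleton_mem_kFaces X u)).elim
  simpa using this

theorem two_mul_card_edges {Q : ℕ} (hQ : ∀ a : V,
    ((kFaces X.toPreAbstractSimplicialComplex 1).filter fun e => a ∈ e).card = Q) :
    2 * (kFaces X.toPreAbstractSimplicialComplex 1).card = Q * Fintype.card V := by
  rw [← sum_card_filter_mem card_eq_two_of_mem_kFaces, Finset.sum_congr rfl fun a _ => hQ a,
    Finset.sum_const, smul_eq_mul, mul_comm, Finset.card_univ]

/-- A `0`-cocycle of a locally constant sheaf on a connected complex that vanishes at a vertex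
is zero. -/
theorem Sheaf.IsLocallyConstant.eq_zero_of_coboundary_eq_zero
    {F : Sheaf.{u, v, w} X.toPreAbstractSimplicialComplex 𝔽} (hF : F.IsLocallyConstant)
    (hX : (underlyingGraph X).Connected) {f : F.Cochain 0} (hf : F.coboundary 0 f = 0) {a : V}
    (ha : f ⟨{a}, singleton_mem_kFaces X a⟩ = 0) : f = 0 := by
  have hP := eq_of_connected hX (fun b => f ⟨{b}, singleton_mem_kFaces X b⟩ = 0) fun b c hbc he => by
    have h := congrFun hf ⟨{b, c}, mem_kFaces.2 ⟨he, Finset.card_pair hbc⟩⟩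
    rw [F.coboundary_zero_apply f hbc (singleton_mem_kFaces X b) (singleton_mem_kFaces X c)] at h
    have hsign : ∀ p q : V, ((orderSign p q : ℤ) : 𝔽) ≠ 0 := by
      intro p q
      unfold orderSign
      split_ifs <;> simp
    apply propext
    constructor
    · intro h0
      rw [h0, map_zero, smul_zero] at h
      exact (map_eq_zero_iff _ (hF.res_injective _)).1
        ((smul_eq_zero.1 ((zero_add _).symm.trans h)).resolve_left (hsign _ _))
    · intro h0
      rw [h0, map_zero, smul_zero] at h
      exact (map_eq_zero_iff _ (hF.res_injective _)).1
        ((smul_eq_zero.1 ((add_zero _).symm.trans h)).resolve_left (hsign _ _))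
  funext ⟨x, hx⟩
  obtain ⟨b, rfl⟩ := Finset.card_eq_one.1 (mem_kFaces.1 hx).2
  exact (hP a b).mp ha

/-- The coboundaries of the `0`-cochains of `F` that vanish at a given vertex and have their
coboundary in the subspaces `U e` are cocycles of the subsheaf, which gives a lower bound on the
dimension of the code. -/
theorem Sheaf.IsLocallyConstant.le_finrank_cocycles_edgeSubsheaf
    {F : Sheaf.{u, v, w} X.toPreAbstractSimplicialComplex 𝔽} (hF : F.IsLocallyConstant)
    (hX : (underlyingGraph X).Connected) {r m : ℕ} (hm : 0 < m) (hrm : r ≤ m) (hdim : F.HasDim m)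
    {U : ∀ e : kFaces X.toPreAbstractSimplicialComplex 1, Submodule 𝔽 (F.obj (toFace e))}
    (hU : ∀ e, Module.finrank 𝔽 (U e) = m - r) :
    m * Fintype.card V ≤ Module.finrank 𝔽 ((edgeSubsheaf F U).toSheaf.cocycles 1) +
      (r * (kFaces X.toPreAbstractSimplicialComplex 1).card + m) := by
  have hfin : ∀ x, Module.Finite 𝔽 (F.obj x) := fun x =>
    Module.finite_of_finrank_pos (by rw [hdim]; exact hm)
  have hfinG : ∀ x, Module.Finite 𝔽 ((edgeSubsheaf F U).toSheaf.obj x) := fun x =>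
    inferInstanceAs (Module.Finite 𝔽 ((edgeSubsheaf F U).carrier x))
  obtain ⟨a⟩ := hX.nonempty
  set Ψ : F.Cochain 0 →ₗ[𝔽] (∀ e, F.obj (toFace e) ⧸ U e) ×
      F.obj (toFace (⟨{a}, singleton_mem_kFaces X a⟩ :
        kFaces X.toPreAbstractSimplicialComplex 0)) :=
    (LinearMap.pi fun e => (U e).mkQ ∘ₗ LinearMap.proj e ∘ₗ F.coboundary 0).prod
      (LinearMap.proj (⟨{a}, singleton_mem_kFaces X a⟩ :
        kFaces X.toPreAbstractSimplicialComplex 0)) with hΨ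
  have hker : ∀ f : LinearMap.ker Ψ, (∀ e, F.coboundary 0 f.1 e ∈ U e) ∧
      f.1 ⟨{a}, singleton_mem_kFaces X a⟩ = 0 := by
    intro f
    have h := LinearMap.mem_ker.1 f.2
    refine ⟨fun e => ?_, (Prod.ext_iff.1 h).2⟩
    exact (Submodule.Quotient.mk_eq_zero _).1 (congrFun (Prod.ext_iff.1 h).1 e)
  let Θ : LinearMap.ker Ψ →ₗ[𝔽] (edgeSubsheaf F U).toSheaf.cocycles 1 :=
    { toFun := fun f => ⟨fun e => ⟨F.coboundary 0 f.1 e, by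
          rw [edgeSubsheaf_carrier_edge]
          exact (hker f).1 e⟩, 
        (Subsheaf.mem_cocycles_iff (edgeSubsheaf F U) 1 _).2
          (LinearMap.mem_ker.2 (F.coboundary_coboundary_zero f.1))⟩
      map_add' := fun f g => by
        ext e
        exact Subtype.ext (congrFun (map_add (F.coboundary 0) f.1 g.1) e)
      map_smul' := fun c f => by
        ext e
        exact Subtype.ext (congrFun (map_smul (F.coboundary 0) c f.1) e) }
  have hΘ : Function.Injective Θ := by
    rw [← LinearMap.ker_eq_bot, LinearMap.ker_eq_bot']
    intro f hf
    apply Subtype.ext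
    refine hF.eq_zero_of_coboundary_eq_zero hX ?_ (hker f).2
    funext e
    exact congrArg Subtype.val (congrFun (congrArg Subtype.val hf) e)
  have h1 := LinearMap.finrank_le_finrank_of_injective hΘ
  have h2 := Ψ.finrank_range_add_finrank_ker
  have h3 := Submodule.finrank_le (LinearMap.range Ψ)
  have h4 : Module.finrank 𝔽 (F.Cochain 0) = m * Fintype.card V := by
    rw [Module.finrank_pi_fintype, Finset.sum_congr rfl fun x _ => hdim (toFace x),
      Finset.sum_const, Finset.card_univ, Fintype.card_coe, card_kFaces_zero, smul_eq_mul, mul_comm]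
  have h5 : ∀ e, Module.finrank 𝔽 (F.obj (toFace e) ⧸ U e) = r := by
    intro e
    have := (U e).finrank_quotient_add_finrank
    rw [hU, hdim] at this
    omega
  rw [Module.finrank_prod, Module.finrank_pi_fintype, Finset.sum_congr rfl fun e _ => h5 e,
    Finset.sum_const, Finset.card_univ, Fintype.card_coe, smul_eq_mul, hdim] at h3
  rw [h4] at h2
  linarith

/-- The rate of a cocycle code is the dimension divided by that of the ambient space. -/
theorem Sheaf.rate_cocycleCode [Finite 𝔽] {K : PreAbstractSimplicialComplex V}
    (G : Sheaf.{u, v, w} K 𝔽) (k n : ℕ) (φ : ∀ x : kFaces K k, G.obj (toFace x) ≃ₗ[𝔽] (Fin n → 𝔽)) :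
    rate (G.cocycleCode k n φ) =
      (Module.finrank 𝔽 (G.cocycles k) : ℝ) / (n * (kFaces K k).card) := by
  let e : G.cocycleCode k n φ ≃ G.cocycles k :=
    { toFun := fun c => ⟨fun x => (φ x).symm (c.1 x), c.2⟩
      invFun := fun f => ⟨fun x => φ x (f.1 x), by
        change (fun x => (φ x).symm (φ x (f.1 x))) ∈ G.cocycles k
        simp only [LinearEquiv.symm_apply_apply]
        exact f.2⟩
      left_inv := fun c => Subtype.ext (funext fun x => (φ x).apply_symm_apply _)
      right_inv := fun f => Subtype.ext (funext fun x => (φ x).symm_apply_apply _) }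
  have hfin : ∀ x : kFaces K k, Module.Finite 𝔽 (G.obj (toFace x)) := fun x =>
    Module.Finite.equiv (φ x).symm
  have hq : (1 : ℝ) < Nat.card 𝔽 := by exact_mod_cast Finite.one_lt_card (α := 𝔽)
  have hlog : Real.log (Nat.card 𝔽) ≠ 0 := (Real.log_pos hq).ne'
  rw [rate, Nat.card_congr e, Module.natCard_eq_pow_finrank (K := 𝔽) (V := G.cocycles k),
    Nat.card_fun, Nat.card_fun, Nat.card_eq_fintype_card (α := Fin n), Fintype.card_fin,
    Nat.card_eq_fintype_card (α := kFaces K k), Fintype.card_coe, ← pow_mul, Real.logb]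
  push_cast
  rw [Real.log_pow, Real.log_pow, mul_div_mul_right _ _ hlog]
  push_cast
  rfl

theorem Sheaf.IsLocallyConstant.le_rate_edgeSubsheaf [Finite 𝔽]
    {F : Sheaf.{u, v, w} X.toPreAbstractSimplicialComplex 𝔽} (hF : F.IsLocallyConstant)
    (hX : (underlyingGraph X).Connected) {Q r m : ℕ} (hQ0 : 0 < Q) (hrm : r < m)
    (hQ : ∀ a : V,
      ((kFaces X.toPreAbstractSimplicialComplex 1).filter fun e => a ∈ e).card = Q)
    (hdim : F.HasDim m)
    {U : ∀ e : kFaces X.toPreAbstractSimplicialComplex 1, Submodule 𝔽 (F.obj (toFace e))}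
    (hU : ∀ e, Module.finrank 𝔽 (U e) = m - r)
    (φ : ∀ e : kFaces X.toPreAbstractSimplicialComplex 1,
      (edgeSubsheaf F U).toSheaf.obj (toFace e) ≃ₗ[𝔽] (Fin (m - r) → 𝔽)) :
    2 / (Q : ℝ) - (r : ℝ) / m - 1 / ((kFaces X.toPreAbstractSimplicialComplex 1).card : ℝ) ≤
      rate ((edgeSubsheaf F U).toSheaf.cocycleCode 1 (m - r) φ) := by
  have hdimle := hF.le_finrank_cocycles_edgeSubsheaf hX (by omega) hrm.le hdim hU
  have hE := two_mul_card_edges hQ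
  have hV : 0 < Fintype.card V := Fintype.card_pos_iff.2 hX.nonempty
  rw [Sheaf.rate_cocycleCode, Nat.cast_sub hrm.le]
  generalize Module.finrank 𝔽 ((edgeSubsheaf F U).toSheaf.cocycles 1) = k at hdimle ⊢
  generalize (kFaces X.toPreAbstractSimplicialComplex 1).card = n at hdimle hE ⊢
  generalize Fintype.card V = N at hdimle hE hV
  have hn : 0 < n := by
    have := Nat.mul_pos hQ0 hV
    omega
  have hnR : (0 : ℝ) < n := by exact_mod_cast hn
  have hQR : (0 : ℝ) < Q := by exact_mod_cast hQ0
  have hmR : (0 : ℝ) < m := by exact_mod_cast (by omega : 0 < m)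
  have hrmR : (r : ℝ) < m := by exact_mod_cast hrm
  have hr0 : (0 : ℝ) ≤ r := by positivity
  have hER : 2 * (n : ℝ) = Q * N := by exact_mod_cast hE
  have hkR : (m : ℝ) * N ≤ k + (r * n + m) := by exact_mod_cast hdimle
  calc 2 / (Q : ℝ) - (r : ℝ) / m - 1 / n = (m * N - r * n - m) / (m * n) := by
        have : 2 / (Q : ℝ) = N / n := by
          rw [div_eq_div_iff hQR.ne' hnR.ne', hER, mul_comm]
        rw [this]
        field_simp
    _ ≤ k / (m * n) := div_le_div_of_nonneg_right (by linarith) (by positivity)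
    _ ≤ k / ((m - r) * n) := by
        refine div_le_div_of_nonneg_left (by positivity) (mul_pos (by linarith) hnR) ?_
        exact mul_le_mul_of_nonneg_right (by linarith) hnR.le

end Dimension

theorem Sheaf.le_relativeDistance_cocycleCode {V : Type u} [Fintype V] [LinearOrder V]
    {K : PreAbstractSimplicialComplex V} {𝔽 : Type v} [Field 𝔽] (G : Sheaf.{u, v, w} K 𝔽)
    (k n : ℕ) (φ : ∀ x : kFaces K k, G.obj (toFace x) ≃ₗ[𝔽] (Fin n → 𝔽)) {δ : ℝ}
    (hG : ∀ f ∈ G.cocycles k, f ≠ 0 → open Classical in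
      δ * (kFaces K k).card ≤ (Finset.univ.filter fun x => f x ≠ 0).card) :
    ENNReal.ofReal δ ≤ relativeDistance (G.cocycleCode k n φ) := by
  classical
  refine le_iInf₂ fun c hc => le_iInf₂ fun c' hc' => le_iInf fun hne => ?_
  obtain ⟨x₀, hx₀⟩ := Function.ne_iff.1 hne
  have hcard : 0 < (kFaces K k).card := Finset.card_pos.2 ⟨x₀.1, x₀.2⟩
  have hcardR : (0 : ℝ) < (kFaces K k).card := by exact_mod_cast hcard
  set f : G.Cochain k := fun x => (φ x).symm (c x) - (φ x).symm (c' x) with hf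
  have hfx : ∀ x, f x ≠ 0 ↔ c x ≠ c' x := fun x => by
    rw [hf, sub_ne_zero, (φ x).symm.injective.ne_iff]
  have h := hG f (Submodule.sub_mem _ hc hc') fun h0 => (hfx x₀).2 hx₀ (congrFun h0 x₀)
  simp only [hfx] at h
  rw [← ENNReal.ofReal_natCast, ← ENNReal.ofReal_natCast, Fintype.card_coe,
    ← ENNReal.ofReal_div_of_pos hcardR]
  refine ENNReal.ofReal_le_ofReal ((le_div_iff₀ hcardR).2 (h.trans (le_of_eq ?_)))
  simp only [hammingDist]

end SheafCode

theorem mainTheorem10 (Q D r m : ℕ) (lam κ : ℝ)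
    (hlam : lam ∈ Set.Icc (-1 : ℝ) 1) (hκ : κ ∈ Set.Icc (1 : ℝ) 2)
    (hr : 0 < r) (hrm : r < m)
    (hlow : κ / Q < (r : ℝ) / m) (hupp : (r : ℝ) / m < 2 / Q)
    (hineq : lam ≤ min
      (1 / 6 * (1 / 4 * (1 - lam) * (1 - (κ / Q) / ((r : ℝ) / m)) - lam) ^ 2 * (1 - lam))
      (1 / 4 * (1 - lam) * (1 - (κ / Q) / ((r : ℝ) / m)))) :
    ∃ δ : ℝ, 0 < δ ∧
      ∀ (V : Type u) [Fintype V] [LinearOrder V] (X : AbstractSimplicialComplex V) (d : ℕ),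
        2 ≤ d →
        IsPure X.toPreAbstractSimplicialComplex d →
        (underlyingGraph X).Connected →
        degree X.toPreAbstractSimplicialComplex d = D →
        (∀ a : V,
          ((kFaces X.toPreAbstractSimplicialComplex 1).filter fun e => a ∈ e).card = Q) →
        (∀ a : V, IsSpectralExpander (link X.toPreAbstractSimplicialComplex {a}) (d - 1)
          (Set.Icc (-1) lam)) →
        (∀ e ∈ kFaces X.toPreAbstractSimplicialComplex 1,
          ∀ e' ∈ kFaces X.toPreAbstractSimplicialComplex 1, (e ∩ e').Nonempty →
            κ⁻¹ * weight X.toPreAbstractSimplicialComplex d e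
                ≤ weight X.toPreAbstractSimplicialComplex d e' ∧
              weight X.toPreAbstractSimplicialComplex d e'
                ≤ κ * weight X.toPreAbstractSimplicialComplex d e) →
        ∀ (𝔽 : Type v) [Field 𝔽] [Finite 𝔽]
          (F : Sheaf.{u, v, w} X.toPreAbstractSimplicialComplex 𝔽),
          F.IsLocallyConstant →
          F.HasDim m →
          ∀ U : ∀ e : kFaces X.toPreAbstractSimplicialComplex 1, Submodule 𝔽 (F.obj (toFace e)),
            (∀ e, Module.finrank 𝔽 (U e) = m - r) →
            GeneralPosition F r m U →
            ∀ φ : ∀ e : kFaces X.toPreAbstractSimplicialComplex 1,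
                (edgeSubsheaf F U).toSheaf.obj (toFace e) ≃ₗ[𝔽] (Fin (m - r) → 𝔽),
              ENNReal.ofReal δ
                  ≤ relativeDistance ((edgeSubsheaf F U).toSheaf.cocycleCode 1 (m - r) φ) ∧
                2 / (Q : ℝ) - (r : ℝ) / m
                    - 1 / ((kFaces X.toPreAbstractSimplicialComplex 1).card : ℝ)
                  ≤ rate ((edgeSubsheaf F U).toSheaf.cocycleCode 1 (m - r) φ) := by
  have hQ0 : 0 < Q := by
    rcases Nat.eq_zero_or_pos Q with rfl | h
    · have : (0 : ℝ) ≤ (r : ℝ) / m := by positivity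
      simp only [Nat.cast_zero, div_zero] at hupp
      linarith
    · exact h
  have hr' : (0 : ℝ) < r := by exact_mod_cast hr
  have hm' : (0 : ℝ) < m := by exact_mod_cast hr.trans hrm
  set ρ : ℝ := 1 - (κ / Q) / ((r : ℝ) / m) with hρ
  have hρ0 : 0 < ρ := by
    have : (κ / Q) / ((r : ℝ) / m) < 1 := (div_lt_one (by positivity)).2 hlow
    linarith
  -- Negative `lam` may be replaced by `0`; then `h = ρ (1 - lam) / 4 - lam` is positive, and the
  -- gap `lam / (1 - lam)` of the underlying graph is at most `h ^ 2 / 6`.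
  obtain ⟨l, h, hl0, hl1, hlaml, hh, hh2, hhρ⟩ : ∃ l h : ℝ, 0 ≤ l ∧ l < 1 ∧ lam ≤ l ∧ 0 < h ∧
      l / (1 - l) ≤ h ^ 2 / 6 ∧ 4 * (l + h) ≤ ρ * (1 - l) := by
    obtain ⟨hi1, hi2⟩ := le_min_iff.1 hineq
    rcases le_or_gt lam 0 with hneg | hpos
    · refine ⟨0, ρ / 4, le_rfl, one_pos, hneg, by positivity, ?_, by linarith⟩
      rw [zero_div]
      positivity
    · have hlt : lam < 1 := by
        refine lt_of_le_of_ne hlam.2 ?_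
        rintro rfl
        norm_num at hi2
      have hne : 1 / 4 * (1 - lam) * ρ - lam ≠ 0 := by
        intro h0
        rw [h0] at hi1
        norm_num at hi1
        linarith
      refine ⟨lam, 1 / 4 * (1 - lam) * ρ - lam, hpos.le, hlt, le_rfl,
        lt_of_le_of_ne (by linarith) hne.symm, ?_, by linarith⟩
      rw [div_le_iff₀ (by linarith)]
      linarith
  -- An edge is in at most `D` faces of dimension `d`, so a support of relative size below `δ` has
  -- relative weight at most `h ^ 3 / 6`. The summand `1` keeps `δ` positive if `D = 0`.
  refine ⟨h ^ 3 / 6 / (D + 1), by positivity, ?_⟩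
  intro V _ _ X d hd hX hconn hD hQ hexp hw 𝔽 _ _ F hF hdim U hU hgen φ
  refine ⟨?_, hF.le_rate_edgeSubsheaf hconn hQ0 hrm hQ hdim hU φ⟩
  have hT := hX.linkGap hd hl0 (lo := -1) fun a μ f hf he =>
    ⟨(hexp a μ f hf he).1, (hexp a μ f hf he).2.trans hlaml⟩
  refine Sheaf.le_relativeDistance_cocycleCode _ 1 (m - r) φ fun f hf hne => ?_
  by_contra! hlt
  have hf0 := eq_zero_of_sparse_of_mem_cocycles hr (hr.trans hrm) hQ0 (by linarith [hκ.1]) hl0 hl1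
    hh hh2 hhρ (by rw [hρ]; ring) hd hX hconn hQ hT
    (fun e he e' he' hee' => (hw e' he' e he (by rwa [Finset.inter_comm])).2) hF hgen
    (fun e => (f e).1) ((Subsheaf.mem_cocycles_iff _ 1 f).1 hf)
    (fun e => (edgeSubsheaf_carrier_edge F U e).le (f e).2) ?_
  · exact hne (funext fun e => Subtype.ext (congrFun hf0 e))
  · classical
    rw [hD]
    rw [div_mul_eq_mul_div, lt_div_iff₀ (by positivity)] at hlt
    have h0 : (0 : ℝ) ≤ (Finset.univ.filter fun x => f x ≠ 0).card := by positivity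
    have h1 : (D : ℝ) * (Finset.univ.filter fun x => f x ≠ 0).card ≤
        h ^ 3 / 6 * (kFaces X.toPreAbstractSimplicialComplex 1).card := by linarith
    refine (mul_le_mul_of_nonneg_left (Nat.cast_le.2 (Finset.card_le_card fun x hx => ?_))
      (Nat.cast_nonneg D)).trans h1
    exact Finset.mem_filter.2 ⟨Finset.mem_univ x, fun h =>
      (Finset.mem_filter.1 hx).2 (congrArg Subtype.val h)⟩
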